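/- A \emph{conflation category} is an additive category with a class of kernel-cokernel pairs $X\to Y\to Z$ (\emph{conflations}), closed under isomorphisms; in a conflation the first map is an \emph{inflation}, the second a \emph{deflation}. A morphism is \emph{admissible} if it is a deflation followed by an inflation. The category is \emph{deflation-exact} if every morphism $X\to 0$ is a deflation, compositions of deflations are deflations, and pullbacks of deflations along arbitrary morphisms exist and are deflations. It has \emph{admissible kernels} if every morphism has a kernel and kernels are inflations. A nonempty full subcategory $\mathcal A$ of a conflation category $\mathcal C$ is \emph{admissibly deflation-percolating} if: (A1) for every conflation $X\to Y\to Z$ one has $Y\in\mathcal A$ if and only if $X,Z\in\mathcal A$; (A2) every morphism $X\to A$ with $A\in\mathcal A$ is a deflation $X\to A'$ followed by an inflation $A'\to A$ with $A'\in\mathcal A$; (A3) a deflation $f\colon X\to A$ with $A\in\mathcal A$ and an inflation $g\colon X\to Y$ have a pushout $P$, in which $Y\to P$ is a deflation and $A\to P$ is an inflation. The quotient $\mathcal C/\mathcal A$ is the localization of $\mathcal C$ at the weak $\mathcal A$-isomorphisms, i.e. the finite compositions of inflations with cokernel in $\mathcal A$ and deflations with kernel in $\mathcal A$; its conflations are the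 sequences isomorphic to images of conflations of $\mathcal C$. For an additive category $\mathcal E$, let $\Upsilon\colon E\mapsto \operatorname{Hom}(-,E)$ be the Yoneda embedding into the category $\operatorname{Mod}(\mathcal E)$ of additive functors $\mathcal E^{\mathrm{op}}\to \mathrm{Ab}$. For a deflation-exact category $\mathcal E$, let $\operatorname{mod}_{\mathrm{ad}}(\mathcal E)$ (respectively $\operatorname{eff}(\mathcal E)$) be the full subcategory of $\operatorname{Mod}(\mathcal E)$ of the functors isomorphic to $\operatorname{coker}\Upsilon(f)$ for some admissible morphism (respectively some deflation) $f$ of $\mathcal E$. The conflations of $\operatorname{mod}_{\mathrm{ad}}(\mathcal E)$ are the short exact sequences of functors with all three terms in it. \textbf{Theorem.} Let $\mathcal E$ be a deflation-exact category with admissible kernels. \begin{enumerate} \item $\operatorname{mod}_{\mathrm{ad}}(\mathcal E)$ is a deflation-exact category with admissible kernels. \item $\operatorname{eff}(\mathcal E)$ is contained in $\operatorname{mod}_{\mathrm{ad}}(\mathcal E)$ and is an admissibly deflation-percolating subcategory of it. \item The composition of $\Upsilon\colon\mathcal E\to\operatorname{mod}_{\mathrm{ad}}(\mathcal E)$ with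 the quotient functor $\operatorname{mod}_{\mathrm{ad}}(\mathcal E)\to\operatorname{mod}_{\mathrm{ad}}(\mathcal E)/\operatorname{eff}(\mathcal E)$ is an equivalence of categories $\mathcal E\simeq \operatorname{mod}_{\mathrm{ad}}(\mathcal E)/\operatorname{eff}(\mathcal E)$, under which a sequence in $\mathcal E$ is a conflation if and only if its image is a conflation. \end{enumerate} -/

import Mathlib

open CategoryTheory CategoryTheory.Limits

universe v u

noncomputable section

/-- A conflation structure on a preadditive category: a class of kernel-cokernel pairs that is
closed under isomorphisms. A conflation category is an additive category with such a structure. -/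
structure ConflationStructure (C : Type u) [Category.{v} C] [Preadditive C] where
  /-- The conflations `X₁ ⟶ X₂ ⟶ X₃`. -/
  conflation : ShortComplex C → Prop
  isKernel : ∀ S : ShortComplex C, conflation S → Nonempty (IsLimit (KernelFork.ofι S.f S.zero))
  isCokernel : ∀ S : ShortComplex C, conflation S →
    Nonempty (IsColimit (CokernelCofork.ofπ S.g S.zero))
  of_iso : ∀ S T : ShortComplex C, (S ≅ T) → conflation S → conflation T

namespace ConflationStructure

section Basic

variable {C : Type u} [Category.{v} C] [Preadditive C] (c : ConflationStructure C)

/-- The inflations: the kernel parts of conflations. -/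
def inflation : MorphismProperty C := fun _ Y i =>
  ∃ (Z : C) (p : Y ⟶ Z) (w : i ≫ p = 0), c.conflation (ShortComplex.mk i p w)

/-- The deflations: the cokernel parts of conflations. -/
def deflation : MorphismProperty C := fun Y _ p =>
  ∃ (X : C) (i : X ⟶ Y) (w : i ≫ p = 0), c.conflation (ShortComplex.mk i p w)

/-- A morphism is admissible if it is a deflation followed by an inflation. -/
def admissible : MorphismProperty C := fun X Y f =>
  ∃ (Z : C) (p : X ⟶ Z) (i : Z ⟶ Y), c.deflation p ∧ c.inflation i ∧ p ≫ i = f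

/-- The category is additive and the conflation structure satisfies the axioms R0, R1 and R2 of a
deflation-exact category. -/
structure IsDeflationExact : Prop where
  additive : HasFiniteBiproducts C
  /-- Every morphism to a zero object is a deflation. -/
  to_zero : ∀ (X Z : C) (f : X ⟶ Z), IsZero Z → c.deflation f
  comp : ∀ {X Y Z : C} (p : X ⟶ Y) (q : Y ⟶ Z),
    c.deflation p → c.deflation q → c.deflation (p ≫ q)
  /-- Pullbacks of deflations exist and are deflations. -/
  pullback : ∀ {Y Z W : C} (p : Y ⟶ Z) (f : W ⟶ Z), c.deflation p →
    ∃ (P : C) (f' : P ⟶ Y) (p' : P ⟶ W), IsPullback f' p' p f ∧ c.deflation p'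

/-- Every morphism has a kernel, and kernels are inflations. -/
def HasAdmissibleKernels : Prop :=
  ∀ {X Y : C} (f : X ⟶ Y), ∃ (K : C) (k : K ⟶ X) (w : k ≫ f = 0),
    Nonempty (IsLimit (KernelFork.ofι k w)) ∧ c.inflation k

/-- The full subcategory on the objects satisfying `A` is an admissibly deflation-percolating
subcategory. -/
structure IsAdmissiblyDeflationPercolating (A : ObjectProperty C) : Prop where
  nonempty : ∃ X : C, A X
  serre : ∀ S : ShortComplex C, c.conflation S → (A S.X₂ ↔ A S.X₁ ∧ A S.X₃)
  /-- Every morphism to an object of `A` is admissible with image in `A`. -/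
  admissible_image : ∀ {X Y : C} (f : X ⟶ Y), A Y →
    ∃ (Z : C) (p : X ⟶ Z) (i : Z ⟶ Y), A Z ∧ c.deflation p ∧ c.inflation i ∧ p ≫ i = f
  /-- A deflation `f` onto an object of `A` and an inflation `g` with the same source have a
  pushout, in which the morphism parallel to `f` is a deflation and the one parallel to `g` is an
  inflation. -/
  pushout : ∀ {X Y Z : C} (f : X ⟶ Z) (g : X ⟶ Y), A Z → c.deflation f → c.inflation g →
    ∃ (P : C) (i' : Z ⟶ P) (f' : Y ⟶ P), IsPushout f g i' f' ∧ c.deflation f' ∧ c.inflation i'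

/-- The weak `A`-isomorphisms: finite compositions of inflations with cokernel in `A` and of
deflations with kernel in `A`. -/
def weakIso (A : ObjectProperty C) : MorphismProperty C :=
  MorphismProperty.multiplicativeClosure fun X Y f =>
    (∃ (Z : C) (p : Y ⟶ Z) (w : f ≫ p = 0), A Z ∧ c.conflation (ShortComplex.mk f p w)) ∨
    (∃ (K : C) (k : K ⟶ X) (w : k ≫ f = 0), A K ∧ c.conflation (ShortComplex.mk k f w))

/-- The quotient `C/A`: the localization of `C` at the weak `A`-isomorphisms. -/
abbrev QuotCat (A : ObjectProperty C) := (c.weakIso A).Localization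

/-- The quotient functor. -/
abbrev quotFunctor (A : ObjectProperty C) : C ⥤ c.QuotCat A := (c.weakIso A).Q

/-- The conflations of `C/A`: the sequences isomorphic to the image of a conflation of `C`, that
is, the smallest class closed under isomorphisms for which the quotient functor preserves
conflations. -/
def quotConflation (A : ObjectProperty C) {X Y Z : c.QuotCat A} (f : X ⟶ Y) (g : Y ⟶ Z) : Prop :=
  ∃ (S : ShortComplex C) (e₁ : (c.quotFunctor A).obj S.X₁ ≅ X)
    (e₂ : (c.quotFunctor A).obj S.X₂ ≅ Y) (e₃ : (c.quotFunctor A).obj S.X₃ ≅ Z),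
    c.conflation S ∧ (c.quotFunctor A).map S.f ≫ e₂.hom = e₁.hom ≫ f ∧
      (c.quotFunctor A).map S.g ≫ e₃.hom = e₂.hom ≫ g

end Basic

section Functors

variable {E : Type u} [Category.{v} E] [Preadditive E]

/-- The contravariant functors from `E` to abelian groups that are isomorphic to the cokernel of
`Hom(-, f)` for a morphism `f` of `E` satisfying `W`. For `W = ⊤`, these are the finitely presented
functors. -/
def presentedBy (W : MorphismProperty E) : ObjectProperty (Eᵒᵖ ⥤ AddCommGrpCat.{v}) := fun F =>
  ∃ (X Y : E) (f : X ⟶ Y), W f ∧ Nonempty (F ≅ cokernel (preadditiveYoneda.map f))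

/-- A functor presented by a morphism is additive, so it makes no difference whether presentations
are formed among all functors or among the additive ones. -/
theorem additive_of_presentedBy {W : MorphismProperty E} {F : Eᵒᵖ ⥤ AddCommGrpCat.{v}}
    (hF : presentedBy W F) : F.Additive := by
  obtain ⟨X, Y, f, -, ⟨e⟩⟩ := hF
  let π : preadditiveYoneda.obj Y ⟶ F := cokernel.π (preadditiveYoneda.map f) ≫ e.inv
  have : Epi π := epi_comp _ _
  refine ⟨fun {A B} a b => ?_⟩
  rw [← cancel_epi (π.app A), ← π.naturality, Functor.map_add, Preadditive.add_comp,
    Preadditive.comp_add, π.naturality, π.naturality]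

variable (c : ConflationStructure E)

/-- The functors presented by admissible morphisms. -/
abbrev modAd : ObjectProperty (Eᵒᵖ ⥤ AddCommGrpCat.{v}) := presentedBy c.admissible

/-- The effaceable functors: those presented by deflations. -/
abbrev eff : ObjectProperty (Eᵒᵖ ⥤ AddCommGrpCat.{v}) := presentedBy c.deflation

/-- The category of functors presented by admissible morphisms. -/
abbrev ModAd := c.modAd.FullSubcategory

/-- The effaceable functors, as objects of the category of functors presented by admissible
morphisms. -/
abbrev effAd : ObjectProperty c.ModAd := c.eff.inverseImage c.modAd.ι

/-- The conflations are the short exact sequences of functors with all terms presented by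
admissible morphisms. -/
def modAdStructure : ConflationStructure c.ModAd where
  conflation S := (S.map c.modAd.ι).ShortExact
  isKernel S h := by
    have := h.mono_f
    have hk := h.exact.fIsKernel
    have hm : Mono S.f := c.modAd.ι.mono_of_mono_map h.mono_f
    refine ⟨KernelFork.IsLimit.ofι' _ _ fun {A} k hk' => ?_⟩
    have hz : k.hom ≫ (S.map c.modAd.ι).g = 0 := congrArg (fun t => t.hom) hk'
    exact ⟨ObjectProperty.homMk (hk.lift (KernelFork.ofι k.hom hz)), ObjectProperty.hom_ext _
      (hk.fac _ WalkingParallelPair.zero)⟩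
  isCokernel S h := by
    have := h.epi_g
    have hk := h.exact.gIsCokernel
    have hm : Epi S.g := c.modAd.ι.epi_of_epi_map h.epi_g
    refine ⟨CokernelCofork.IsColimit.ofπ' _ _ fun {A} k hk' => ?_⟩
    have hz : (S.map c.modAd.ι).f ≫ k.hom = 0 := congrArg (fun t => t.hom) hk'
    exact ⟨ObjectProperty.homMk (hk.desc (CokernelCofork.ofπ k.hom hz)), ObjectProperty.hom_ext _
      (hk.fac _ WalkingParallelPair.one)⟩
  of_iso S T e h := by
    exact ShortComplex.shortExact_of_iso (c.modAd.ι.mapShortComplex.mapIso e) h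

variable {c}

theorem IsDeflationExact.id_zero_conflation (hc : c.IsDeflationExact) {Z : E} (hZ : IsZero Z)
    (X : E) : c.conflation (ShortComplex.mk (0 : Z ⟶ X) (𝟙 X) (by simp)) := by
  obtain ⟨P, f', p', sq, A, i, w, hp⟩ :=
    hc.pullback (𝟙 Z) (0 : X ⟶ Z) (hc.to_zero Z Z _ hZ)
  have : IsIso p' := sq.isIso_snd_of_isIso
  obtain ⟨hl⟩ := c.isKernel _ hp
  have hi : i = 0 := by
    rw [← cancel_mono p', zero_comp]
    exact w
  have hA : IsZero A := by
    rw [IsZero.iff_id_eq_zero]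
    apply Fork.IsLimit.hom_ext hl
    simp [hi]
  refine c.of_iso _ _ (ShortComplex.isoMk (hA.iso hZ) (asIso p') (Iso.refl X) ?_ ?_) hp
  · exact hA.eq_of_src _ _
  · simp

theorem IsDeflationExact.modAd_yoneda (hc : c.IsDeflationExact) (X : E) :
    c.modAd (preadditiveYoneda.obj X) := by
  have := hc.additive
  obtain ⟨Z, hZ⟩ := hasZeroObject_of_hasFiniteBiproducts E |>.zero
  refine ⟨Z, X, 0, ⟨Z, 𝟙 Z, 0, ?_, ?_, by simp⟩, ⟨?_⟩⟩
  · exact hc.to_zero _ _ _ hZ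
  · exact ⟨X, 𝟙 X, by simp, hc.id_zero_conflation hZ X⟩
  · have h0 : (preadditiveYoneda.map (0 : Z ⟶ X)) = 0 := by
      ext A g
      exact comp_zero
    exact (cokernelZeroIsoTarget (X := preadditiveYoneda.obj Z)).symm ≪≫
      cokernelIsoOfEq h0.symm

/-- The Yoneda embedding `X ↦ Hom(-, X)`, as a functor to the category of functors presented by
admissible morphisms. -/
def yonedaAd (hc : c.IsDeflationExact) : E ⥤ c.ModAd :=
  c.modAd.lift preadditiveYoneda hc.modAd_yoneda

end Functors

end ConflationStructure

end

open Opposite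

noncomputable section

namespace ConflationStructure

/-! ### Deflations and monomorphisms: factorisation and cancellation in the presence of admissible
kernels. -/

section RegularCategory

variable {C : Type u} [Category.{v} C] [Preadditive C] {c : ConflationStructure C}

/-! Deflations serve as one-element covers: they compose and are stable under pullback. "Locally"
means after restriction along a deflation. Since a deflation is the cokernel of its kernel,
representable functors are sheaves for these covers.

Kernels in `E` make every finitely presented functor coherent: it has a generator, and the
annihilator of each element is generated by one morphism. Within the coherent functors, the
effaceable ones are those that vanish locally (`eff_iff`), and the ones presented by admissible
morphisms are those with a locally injective map to a representable functor (`modAd_of_locInj`,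
`exists_locInj_locSurj`). The latter class is closed under finitely generated subfunctors
(`modAd_of_mono`), hence under kernels and images. This gives the first claim, and local vanishing
gives the percolating axioms.

For the quotient, the weak isomorphisms are the locally bijective maps (`weakIso_iff`). Each functor
in the category has a locally bijective map to a representable one, which by the sheaf property is a
reflection (`existsUnique_reflection`). So the Yoneda embedding has a left adjoint, which inverts
exactly the weak isomorphisms (`isIso_refl_map_iff`) and is therefore the localization. It preserves
conflations (`conflation_refl`). Conversely, a conflation of `E` becomes short exact once its last
term is replaced by an image weakly isomorphic to it. -/

theorem deflation.epi {X Y : C} {p : X ⟶ Y} (hp : c.deflation p) : Epi p := by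
  obtain ⟨K, k, w, h⟩ := hp
  obtain ⟨hl⟩ := c.isCokernel _ h
  exact Cofork.IsColimit.epi hl

theorem inflation.mono {X Y : C} {i : X ⟶ Y} (hi : c.inflation i) : Mono i := by
  obtain ⟨K, k, w, h⟩ := hi
  obtain ⟨hl⟩ := c.isKernel _ h
  exact Fork.IsLimit.mono hl

/-- A morphism killed by everything that a deflation kills descends along the deflation. -/
theorem deflation.exists_desc {X Y Z : C} {p : X ⟶ Y} (hp : c.deflation p) (f : X ⟶ Z)
    (hf : ∀ (T : C) (t : T ⟶ X), t ≫ p = 0 → t ≫ f = 0) : ∃ g : Y ⟶ Z, p ≫ g = f := by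
  obtain ⟨K, k, w, h⟩ := hp
  obtain ⟨hl⟩ := c.isCokernel _ h
  exact ⟨hl.desc (CokernelCofork.ofπ f (hf _ k w)), hl.fac _ WalkingParallelPair.one⟩

theorem conflation.exists_lift {S : ShortComplex C} (h : c.conflation S) {T : C} (t : T ⟶ S.X₂)
    (ht : t ≫ S.g = 0) : ∃ s : T ⟶ S.X₁, s ≫ S.f = t := by
  obtain ⟨hl⟩ := c.isKernel _ h
  exact ⟨hl.lift (KernelFork.ofι t ht), hl.fac _ WalkingParallelPair.zero⟩

theorem deflation.comp_isIso {X Y Z : C} {p : X ⟶ Y} (hp : c.deflation p) (e : Y ⟶ Z) [IsIso e] :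
    c.deflation (p ≫ e) := by
  obtain ⟨K, k, w, h⟩ := hp
  refine ⟨K, k, by rw [← Category.assoc, w, zero_comp], c.of_iso _ _ ?_ h⟩
  exact ShortComplex.isoMk (Iso.refl _) (Iso.refl _) (asIso e) (by simp) (by simp)

theorem deflation.isIso {X Y : C} {p : X ⟶ Y} (hp : c.deflation p) [Mono p] : IsIso p := by
  obtain ⟨g, hg⟩ := hp.exists_desc (𝟙 X) fun T t ht => by
    rw [← cancel_mono p, Category.comp_id, ht, zero_comp]
  exact ⟨g, hg, by have := hp.epi; rw [← cancel_epi p]; simp [reassoc_of% hg]⟩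

/-- A monomorphism with the universal property of the kernel of a deflation is the inflation of a
conflation. -/
theorem deflation.conflation {S : ShortComplex C} (hg : c.deflation S.g) [Mono S.f]
    (hS : ∀ (T : C) (t : T ⟶ S.X₂), t ≫ S.g = 0 → ∃ s : T ⟶ S.X₁, s ≫ S.f = t) :
    c.conflation S := by
  obtain ⟨K, k, w, h⟩ := hg
  obtain ⟨a, ha⟩ := hS K k w
  obtain ⟨b, hb⟩ := conflation.exists_lift h S.f S.zero
  dsimp at b hb
  have hk : Mono k := inflation.mono (c := c) ⟨_, _, w, h⟩
  refine c.of_iso (ShortComplex.mk k S.g w) S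
    (ShortComplex.isoMk ⟨a, b, ?_, ?_⟩ (Iso.refl _) (Iso.refl _) ?_ ?_) h
  · rw [← cancel_mono k]; simp [ha, hb]
  · rw [← cancel_mono S.f]; simp [ha, hb]
  · simp [ha]
  · simp

/-- In a deflation-exact category with admissible kernels, every morphism is a deflation followed
by a monomorphism. -/
theorem IsDeflationExact.exists_deflation_mono (hc : c.IsDeflationExact)
    (hk : c.HasAdmissibleKernels) {X Y : C} (f : X ⟶ Y) :
    ∃ (I : C) (q : X ⟶ I) (m : I ⟶ Y), c.deflation q ∧ Mono m ∧ q ≫ m = f := by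
  obtain ⟨K, k, wk, ⟨hl⟩, J, q, wq, hq⟩ := hk f
  have hdq : c.deflation q := ⟨_, _, _, hq⟩
  obtain ⟨m, hm⟩ := hdq.exists_desc f fun T t ht => by
    obtain ⟨s, rfl⟩ := conflation.exists_lift hq t ht
    simp [wk]
  refine ⟨J, q, m, hdq, Preadditive.mono_of_cancel_zero _ fun {T} t ht => ?_, hm⟩
  -- To see that `m` is mono, lift `t` along `q` over a cover: the lift is killed by `f`, so it
  -- factors through `k` and is killed by `q`.
  obtain ⟨P, t', p', sq, hp'⟩ := hc.pullback q t hdq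
  have := hp'.epi
  have h0 : t' ≫ f = 0 := by rw [← hm, sq.w_assoc, ht, comp_zero]
  have h1 := hl.fac (KernelFork.ofι t' h0) WalkingParallelPair.zero
  dsimp at h1
  rw [← cancel_epi p', ← sq.w, ← h1, Category.assoc, wq, comp_zero, comp_zero]

/-- Write `p` as a deflation `q` followed by a mono `m`. Descending `s ≫ q` along `s ≫ p` gives a
section of `m`, so `m` is invertible. -/
theorem IsDeflationExact.deflation_of_comp (hc : c.IsDeflationExact)
    (hk : c.HasAdmissibleKernels) {X Y Z : C} {s : X ⟶ Y} {p : Y ⟶ Z}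
    (h : c.deflation (s ≫ p)) : c.deflation p := by
  obtain ⟨I, q, m, hq, hm, rfl⟩ := hc.exists_deflation_mono hk p
  obtain ⟨n, hn⟩ := h.exists_desc (s ≫ q) fun T t ht => by
    rw [← cancel_mono m]; simpa using ht
  have := h.epi
  have h1 : n ≫ m = 𝟙 _ := by
    rw [← cancel_epi (s ≫ q ≫ m), ← Category.assoc, hn]; simp
  have : IsIso m := ⟨n, by rw [← cancel_mono m]; simp [h1], h1⟩
  exact hq.comp_isIso m

theorem IsDeflationExact.deflation_id (hc : c.IsDeflationExact) (X : C) : c.deflation (𝟙 X) := by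
  have := hc.additive
  obtain ⟨Z, hZ⟩ := hasZeroObject_of_hasFiniteBiproducts C |>.zero
  exact ⟨_, _, _, hc.id_zero_conflation hZ X⟩

end RegularCategory

/-! ### Elementwise calculus for presheaves of abelian groups, and annihilators of elements. -/

section Elements

variable {E : Type u} [Category.{v} E] {F G H : Eᵒᵖ ⥤ AddCommGrpCat.{v}}

/-- Restriction of an element of a presheaf of abelian groups along a morphism. -/
def res (F : Eᵒᵖ ⥤ AddCommGrpCat.{v}) {S T : E} (t : S ⟶ T) : F.obj (op T) →+ F.obj (op S) :=
  (F.map t.op).hom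

/-- The component at an object of a morphism of presheaves of abelian groups. -/
def ev (φ : F ⟶ G) (T : E) : F.obj (op T) →+ G.obj (op T) :=
  (φ.app (op T)).hom

theorem res_id (T : E) (x : F.obj (op T)) : res F (𝟙 T) x = x := by simp [res]

theorem res_res {R S T : E} (s : R ⟶ S) (t : S ⟶ T) (x : F.obj (op T)) :
    res F s (res F t x) = res F (s ≫ t) x := by simp [res]

theorem ev_res (φ : F ⟶ G) {S T : E} (t : S ⟶ T) (x : F.obj (op T)) :
    ev φ S (res F t x) = res G t (ev φ T x) :=
  ConcreteCategory.congr_hom (φ.naturality t.op) x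

theorem ev_comp (φ : F ⟶ G) (ψ : G ⟶ H) (T : E) (x : F.obj (op T)) :
    ev (φ ≫ ψ) T x = ev ψ T (ev φ T x) := rfl

theorem ev_id (T : E) (x : F.obj (op T)) : ev (𝟙 F) T x = x := rfl

theorem ev_zero (T : E) (x : F.obj (op T)) : ev (0 : F ⟶ G) T x = 0 := rfl

theorem ev_add (φ ψ : F ⟶ G) (T : E) (x : F.obj (op T)) :
    ev (φ + ψ) T x = ev φ T x + ev ψ T x := rfl

theorem hom_ext_ev {φ ψ : F ⟶ G} (h : ∀ T x, ev φ T x = ev ψ T x) : φ = ψ := by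
  ext T x
  exact h T.unop x

theorem mono_iff_ev (φ : F ⟶ G) : Mono φ ↔ ∀ T x, ev φ T x = 0 → x = 0 := by
  rw [NatTrans.mono_iff_mono_app]
  simp only [AddCommGrpCat.mono_iff_injective]
  exact ⟨fun h T => (injective_iff_map_eq_zero (φ.app (op T)).hom).1 (h (op T)),
    fun h T => (injective_iff_map_eq_zero (φ.app T).hom).2 (h T.unop)⟩

theorem epi_iff_ev (φ : F ⟶ G) : Epi φ ↔ ∀ T y, ∃ x, ev φ T x = y := by
  rw [NatTrans.epi_iff_epi_app]
  simp only [AddCommGrpCat.epi_iff_surjective]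
  exact ⟨fun h T => h (op T), fun h T => h T.unop⟩

theorem exact_iff_ev (S : ShortComplex (Eᵒᵖ ⥤ AddCommGrpCat.{v})) :
    S.Exact ↔ ∀ T x, ev S.g T x = 0 → ∃ w, ev S.f T w = x := by
  constructor
  · intro h T x hx
    exact (ShortComplex.ab_exact_iff _).1 (h.map ((evaluation _ _).obj (op T))) x hx
  · intro h
    rw [ShortComplex.exact_iff_epi_kernel_lift, epi_iff_ev]
    intro T z
    obtain ⟨w, hw⟩ := h T (ev (kernel.ι S.g) T z) (by
      rw [← ev_comp, kernel.condition, ev_zero])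
    refine ⟨w, ?_⟩
    have := (mono_iff_ev (kernel.ι S.g)).1 inferInstance T
      (ev (kernel.lift S.g S.f S.zero) T w - z) (by
        rw [map_sub, ← ev_comp, kernel.lift_ι, hw, sub_self])
    exact sub_eq_zero.1 this

theorem shortExact_of_ev (S : ShortComplex (Eᵒᵖ ⥤ AddCommGrpCat.{v})) [Mono S.f] [Epi S.g]
    (h : ∀ T x, ev S.g T x = 0 → ∃ w, ev S.f T w = x) : S.ShortExact where
  exact := (exact_iff_ev S).2 h

theorem exists_ev_kernel (φ : F ⟶ G) {T : E} (x : F.obj (op T)) (hx : ev φ T x = 0) :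
    ∃ w, ev (kernel.ι φ) T w = x :=
  (exact_iff_ev _).1 (ShortComplex.exact_kernel φ) T x hx

theorem exists_ev_cokernel (φ : F ⟶ G) {T : E} (x : G.obj (op T))
    (hx : ev (cokernel.π φ) T x = 0) : ∃ w, ev φ T w = x :=
  (exact_iff_ev _).1 (ShortComplex.exact_cokernel φ) T x hx

theorem eq_of_ev_eq (φ : F ⟶ G) [Mono φ] {T : E} {x y : F.obj (op T)}
    (h : ev φ T x = ev φ T y) : x = y :=
  sub_eq_zero.1 ((mono_iff_ev φ).1 inferInstance T _ (by rw [map_sub, h, sub_self]))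

theorem exists_ev_eq (φ : F ⟶ G) [Epi φ] {T : E} (y : G.obj (op T)) : ∃ x, ev φ T x = y :=
  (epi_iff_ev φ).1 inferInstance T y

theorem ev_biprod_eq_zero {T : E} (w : (F ⊞ G).obj (op T)) (h₁ : ev (biprod.fst : F ⊞ G ⟶ F) T w = 0)
    (h₂ : ev (biprod.snd : F ⊞ G ⟶ G) T w = 0) : w = 0 := by
  rw [← ev_id T w, ← biprod.total, ev_add, ev_comp, ev_comp, h₁, h₂, map_zero, map_zero, add_zero]

/-- The annihilators of the elements of the functor are generated by a single morphism. -/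
def HasFGRelations (F : Eᵒᵖ ⥤ AddCommGrpCat.{v}) : Prop :=
  ∀ (A : E) (a : F.obj (op A)), ∃ (P : E) (p : P ⟶ A), res F p a = 0 ∧
    ∀ (T : E) (t : T ⟶ A), res F t a = 0 → ∃ s, s ≫ p = t

theorem HasFGRelations.of_mono (hG : HasFGRelations G) (φ : F ⟶ G) [Mono φ] :
    HasFGRelations F := by
  intro A a
  obtain ⟨P, p, hp, h⟩ := hG A (ev φ A a)
  refine ⟨P, p, (mono_iff_ev φ).1 inferInstance _ _ (by rw [ev_res, hp]), fun T t ht => h T t ?_⟩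
  rw [← ev_res, ht, map_zero]

end Elements

/-! ### Coherent functors and their closure properties. -/

section Coherent

variable {E : Type u} [Category.{v} E] [Preadditive E] {F G H : Eᵒᵖ ⥤ AddCommGrpCat.{v}}

/-- A morphism, as an element of the functor represented by its target. -/
def sec {T X : E} : (T ⟶ X) ≃+ (preadditiveYoneda.obj X).obj (op T) := AddEquiv.refl (T ⟶ X)

theorem exists_sec_eq {T X : E} (x : (preadditiveYoneda.obj X).obj (op T)) :
    ∃ t : T ⟶ X, sec t = x := sec.surjective x

theorem res_sec {R S X : E} (t : R ⟶ S) (x : S ⟶ X) :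
    res (preadditiveYoneda.obj X) t (sec x) = sec (t ≫ x) := rfl

theorem ev_sec {T X Y : E} (t : T ⟶ X) (f : X ⟶ Y) :
    ev (preadditiveYoneda.map f) T (sec t) = sec (t ≫ f) := rfl

/-- The element corresponding to a morphism from a representable functor. -/
def elt {Y : E} (π : preadditiveYoneda.obj Y ⟶ F) : F.obj (op Y) := ev π Y (sec (𝟙 Y))

theorem ev_eq_res_elt {Y : E} (π : preadditiveYoneda.obj Y ⟶ F) {T : E} (t : T ⟶ Y) :
    ev π T (sec t) = res F t (elt π) := by
  rw [elt, ← ev_res, res_sec, Category.comp_id]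

theorem exists_res_elt {Y : E} (π : preadditiveYoneda.obj Y ⟶ F) [Epi π] {T : E}
    (x : F.obj (op T)) : ∃ t : T ⟶ Y, res F t (elt π) = x := by
  obtain ⟨x, rfl⟩ := exists_ev_eq π x
  obtain ⟨t, rfl⟩ := exists_sec_eq x
  exact ⟨t, by rw [← ev_eq_res_elt]⟩

theorem hom_ext_sec {Y : E} {φ ψ : preadditiveYoneda.obj Y ⟶ F}
    (h : ∀ T (t : T ⟶ Y), ev φ T (sec t) = ev ψ T (sec t)) : φ = ψ :=
  hom_ext_ev fun T x => by
    obtain ⟨t, rfl⟩ := exists_sec_eq x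
    exact h T t

/-- The functor is a quotient of a representable functor. -/
def IsFG (F : Eᵒᵖ ⥤ AddCommGrpCat.{v}) : Prop :=
  ∃ (Y : E) (π : preadditiveYoneda.obj Y ⟶ F), Epi π

/-- Coherence of a functor: it is finitely generated with finitely generated relations. -/
structure IsCoherentFunctor (F : Eᵒᵖ ⥤ AddCommGrpCat.{v}) : Prop where
  fg : IsFG F
  rel : HasFGRelations F

theorem IsFG.of_epi (hF : IsFG F) (φ : F ⟶ G) [Epi φ] : IsFG G := by
  obtain ⟨Y, π, _⟩ := hF
  exact ⟨Y, π ≫ φ, epi_comp _ _⟩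

/-- If `y` generates `F` and `p` generates the annihilator of `φ y`, then the restriction of `y`
along `p` generates the kernel. -/
theorem IsFG.kernel (hF : IsFG F) (hG : HasFGRelations G) (φ : F ⟶ G) : IsFG (kernel φ) := by
  obtain ⟨Y, π, _⟩ := hF
  obtain ⟨P, p, hp, h⟩ := hG Y (ev φ Y (elt π))
  refine ⟨P, kernel.lift φ (preadditiveYoneda.map p ≫ π) ?_, ?_⟩
  · refine hom_ext_sec fun T x => ?_
    rw [ev_comp, ev_comp, ev_sec, ev_eq_res_elt, ev_res, ← res_res, hp, map_zero, ev_zero]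
  · rw [epi_iff_ev]
    intro T y
    obtain ⟨t, ht⟩ := exists_res_elt π (ev (kernel.ι φ) T y)
    obtain ⟨s, hs⟩ := h T t (by rw [← ev_res, ht, ← ev_comp, kernel.condition, ev_zero])
    refine ⟨sec s, eq_of_ev_eq (kernel.ι φ) ?_⟩
    rw [← ev_comp, kernel.lift_ι, ev_comp, ev_sec, ev_eq_res_elt, hs, ht]

theorem IsCoherentFunctor.of_mono (hG : IsCoherentFunctor G) (φ : F ⟶ G) [Mono φ] (hF : IsFG F) :
    IsCoherentFunctor F :=
  ⟨hF, hG.rel.of_mono φ⟩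

/-- The cokernel of a morphism from a finitely generated functor to a coherent one is coherent. -/
theorem IsCoherentFunctor.cokernel [HasBinaryBiproducts E] (hF : IsFG F)
    (hG : IsCoherentFunctor G) (φ : F ⟶ G) : IsCoherentFunctor (cokernel φ) := by
  refine ⟨hG.fg.of_epi (cokernel.π φ), fun A a => ?_⟩
  obtain ⟨Y, π, _⟩ := hF
  obtain ⟨b, rfl⟩ := exists_ev_eq (cokernel.π φ) a
  -- A morphism `t` kills the class of `b` when `t` restricts `b` to a restriction of the image of
  -- the generator along some `r`. Such pairs `(t, r)` are the annihilator of this difference over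
  -- `A ⊞ Y`.
  obtain ⟨P, p, hp, h⟩ := hG.rel (A ⊞ Y) (res G biprod.fst b - res G biprod.snd (ev φ Y (elt π)))
  refine ⟨P, p ≫ biprod.fst, ?_, fun T t ht => ?_⟩
  · rw [map_sub, res_res, res_res, sub_eq_zero, ← ev_res] at hp
    rw [← ev_res, hp, ← ev_comp, cokernel.condition, ev_zero]
  · rw [← ev_res] at ht
    obtain ⟨w, hw⟩ := exists_ev_cokernel φ _ ht
    obtain ⟨r, rfl⟩ := exists_res_elt π w
    obtain ⟨s, hs⟩ := h T (biprod.lift t r) (by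
      rw [map_sub, res_res, res_res, biprod.lift_fst, biprod.lift_snd, ← hw, ev_res, sub_self])
    exact ⟨s, by rw [reassoc_of% hs, biprod.lift_fst]⟩

theorem IsCoherentFunctor.biprod [HasBinaryBiproducts E] (hF : IsCoherentFunctor F)
    (hG : IsCoherentFunctor G) : IsCoherentFunctor (F ⊞ G) := by
  refine ⟨?_, fun A a => ?_⟩
  · obtain ⟨Y, π, _⟩ := hF.fg
    obtain ⟨Z, ρ, _⟩ := hG.fg
    refine ⟨Y ⊞ Z, biprod.lift (preadditiveYoneda.map biprod.fst ≫ π)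
      (preadditiveYoneda.map biprod.snd ≫ ρ), ?_⟩
    rw [epi_iff_ev]
    intro T w
    obtain ⟨s, hs⟩ := exists_res_elt π (ev biprod.fst T w)
    obtain ⟨t, ht⟩ := exists_res_elt ρ (ev biprod.snd T w)
    refine ⟨sec (biprod.lift s t), sub_eq_zero.1 (ev_biprod_eq_zero _ ?_ ?_)⟩
    · rw [map_sub, ← ev_comp, biprod.lift_fst, ev_comp, ev_sec, biprod.lift_fst,
        ev_eq_res_elt, hs, sub_self]
    · rw [map_sub, ← ev_comp, biprod.lift_snd, ev_comp, ev_sec, biprod.lift_snd,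
        ev_eq_res_elt, ht, sub_self]
  -- The annihilator of a pair is found in two stages: that of the first component, then, over its
  -- generator, that of the second.
  · obtain ⟨P, p, hp, h⟩ := hF.rel A (ev biprod.fst A a)
    obtain ⟨Q, q, hq, k⟩ := hG.rel P (res G p (ev biprod.snd A a))
    refine ⟨Q, q ≫ p, ev_biprod_eq_zero _ ?_ ?_, fun T t ht => ?_⟩
    · rw [ev_res, ← res_res, hp, map_zero]
    · rw [ev_res, ← res_res, hq]
    · obtain ⟨s, rfl⟩ := h T t (by rw [← ev_res, ht, map_zero])
      obtain ⟨r, rfl⟩ := k T s (by rw [res_res, ← ev_res, ht, map_zero])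
      exact ⟨r, by simp⟩

theorem IsCoherentFunctor.of_iso (hF : IsCoherentFunctor F) (e : F ≅ G) : IsCoherentFunctor G :=
  hF.of_mono e.inv (hF.fg.of_epi e.hom)

theorem isFG_yoneda (X : E) : IsFG (preadditiveYoneda.obj X) := ⟨X, 𝟙 _, inferInstance⟩

end Coherent

/-! ### Local vanishing, injectivity and surjectivity, and the local description of `modAd` and
`eff`. -/

section Local

variable {E : Type u} [Category.{v} E] [Preadditive E] (c : ConflationStructure E)
  {F G H : Eᵒᵖ ⥤ AddCommGrpCat.{v}}

/-- The element vanishes after restriction along a deflation. -/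
def IsLocZero {T : E} (x : F.obj (op T)) : Prop :=
  ∃ (S : E) (p : S ⟶ T), c.deflation p ∧ res F p x = 0

/-- All elements of the functor vanish locally. -/
def LocZero (F : Eᵒᵖ ⥤ AddCommGrpCat.{v}) : Prop :=
  ∀ (T : E) (x : F.obj (op T)), c.IsLocZero x

/-- The kernel of the morphism vanishes locally. -/
def LocInj (φ : F ⟶ G) : Prop :=
  ∀ (T : E) (x : F.obj (op T)), ev φ T x = 0 → c.IsLocZero x

/-- Every element of the target lifts locally to the source. -/
def LocSurj (φ : F ⟶ G) : Prop :=
  ∀ (T : E) (y : G.obj (op T)), ∃ (S : E) (p : S ⟶ T) (x : F.obj (op S)),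
    c.deflation p ∧ ev φ S x = res G p y

variable {c}

theorem IsLocZero.ev {T : E} {x : F.obj (op T)} (h : c.IsLocZero x) (φ : F ⟶ G) :
    c.IsLocZero (ev φ T x) := by
  obtain ⟨S, p, hp, hx⟩ := h
  exact ⟨S, p, hp, by rw [← ev_res, hx, map_zero]⟩

variable (hc : c.IsDeflationExact)
include hc

theorem isLocZero_of_res {S T : E} {p : S ⟶ T} (hp : c.deflation p) {x : F.obj (op T)}
    (h : c.IsLocZero (res F p x)) : c.IsLocZero x := by
  obtain ⟨R, q, hq, hx⟩ := h
  exact ⟨R, q ≫ p, hc.comp _ _ hq hp, by rw [← res_res, hx]⟩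

theorem isLocZero_zero (T : E) : c.IsLocZero (0 : F.obj (op T)) :=
  ⟨T, 𝟙 T, hc.deflation_id T, map_zero _⟩

theorem LocInj.isLocZero {φ : F ⟶ G} (h : c.LocInj φ) {T : E} {x : F.obj (op T)}
    (hx : c.IsLocZero (ConflationStructure.ev φ T x)) : c.IsLocZero x := by
  obtain ⟨S, p, hp, h0⟩ := hx
  exact isLocZero_of_res hc hp (h _ _ (by rw [ev_res, h0]))

theorem locInj_of_mono (φ : F ⟶ G) [Mono φ] : c.LocInj φ := fun T x hx => by
  rw [(mono_iff_ev φ).1 inferInstance T x hx]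
  exact isLocZero_zero hc T

theorem locSurj_of_epi (φ : F ⟶ G) [Epi φ] : c.LocSurj φ := fun T y => by
  obtain ⟨x, rfl⟩ := exists_ev_eq φ y
  exact ⟨T, 𝟙 T, x, hc.deflation_id T, by rw [res_id]⟩

theorem LocInj.comp {φ : F ⟶ G} {ψ : G ⟶ H} (hφ : c.LocInj φ) (hψ : c.LocInj ψ) :
    c.LocInj (φ ≫ ψ) := fun T x hx =>
  hφ.isLocZero hc (hψ T _ (by rwa [ev_comp] at hx))

theorem LocSurj.comp {φ : F ⟶ G} {ψ : G ⟶ H} (hφ : c.LocSurj φ) (hψ : c.LocSurj ψ) :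
    c.LocSurj (φ ≫ ψ) := fun T z => by
  obtain ⟨S, p, y, hp, hy⟩ := hψ T z
  obtain ⟨R, q, x, hq, hx⟩ := hφ S y
  exact ⟨R, q ≫ p, x, hc.comp _ _ hq hp, by rw [ev_comp, hx, ev_res, hy, res_res]⟩

omit hc in
theorem LocInj.of_comp {φ : F ⟶ G} {ψ : G ⟶ H} (h : c.LocInj (φ ≫ ψ)) : c.LocInj φ :=
  fun T x hx => h T x (by rw [ev_comp, hx, map_zero])

omit hc in
theorem LocSurj.of_comp {φ : F ⟶ G} {ψ : G ⟶ H} (h : c.LocSurj (φ ≫ ψ)) : c.LocSurj ψ :=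
  fun T z => by
    obtain ⟨S, p, x, hp, hx⟩ := h T z
    exact ⟨S, p, ConflationStructure.ev φ S x, hp, hx⟩

/-- A local lift of `ψ y` through `φ ≫ ψ` has the same image under `ψ` as `y`, so its image under
`φ` agrees with `y` on a finer cover. -/
theorem LocSurj.of_comp_locInj {φ : F ⟶ G} {ψ : G ⟶ H} (h : c.LocSurj (φ ≫ ψ))
    (hψ : c.LocInj ψ) : c.LocSurj φ := fun T y => by
  obtain ⟨S, p, x, hp, hx⟩ := h T (ConflationStructure.ev ψ T y)
  obtain ⟨R, q, hq, h0⟩ := hψ S (ConflationStructure.ev φ S x - ConflationStructure.res G p y) (by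
    rw [map_sub, ← ev_comp, hx, ev_res, sub_self])
  rw [map_sub, sub_eq_zero, res_res] at h0
  exact ⟨R, q ≫ p, ConflationStructure.res F q x, hc.comp _ _ hq hp, by rw [ev_res, h0]⟩

theorem LocInj.of_comp_locSurj {φ : F ⟶ G} {ψ : G ⟶ H} (h : c.LocInj (φ ≫ ψ))
    (hφ : c.LocSurj φ) : c.LocInj ψ := fun T y hy => by
  obtain ⟨S, p, x, hp, hx⟩ := hφ T y
  refine isLocZero_of_res hc hp ?_
  rw [← hx]
  exact (h S x (by rw [ev_comp, hx, ev_res, hy, map_zero])).ev φ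

omit hc in
-- Representable functors are separated, because deflations are epimorphisms.
theorem IsLocZero.eq_zero {T X : E} {t : T ⟶ X} (h : c.IsLocZero (sec t)) : t = 0 := by
  obtain ⟨S, p, hp, h0⟩ := h
  have := hp.epi
  rw [res_sec, AddEquiv.map_eq_zero_iff] at h0
  rw [← cancel_epi p, h0, comp_zero]

omit hc in
theorem LocInj.mono {X Y : E} {f : X ⟶ Y} (h : c.LocInj (preadditiveYoneda.map f)) : Mono f :=
  Preadditive.mono_of_cancel_zero _ fun {T} t ht =>
    IsLocZero.eq_zero (h T (sec t) (by rw [ev_sec, ht, map_zero]))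

/-- A local lift of the identity of `Y` exhibits a deflation factoring through `f`, so cancellation
applies. -/
theorem LocSurj.deflation (hk : c.HasAdmissibleKernels) {X Y : E} {f : X ⟶ Y}
    (h : c.LocSurj (preadditiveYoneda.map f)) : c.deflation f := by
  obtain ⟨S, p, x, hp, hx⟩ := h Y (sec (𝟙 Y))
  obtain ⟨x, rfl⟩ := exists_sec_eq x
  rw [ev_sec, res_sec, EmbeddingLike.apply_eq_iff_eq, Category.comp_id] at hx
  exact hc.deflation_of_comp hk (s := x) (by rwa [hx])

omit hc in
theorem isCoherentFunctor_yoneda (hk : c.HasAdmissibleKernels) (X : E) :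
    IsCoherentFunctor (preadditiveYoneda.obj X) := by
  refine ⟨isFG_yoneda X, fun A a => ?_⟩
  obtain ⟨a, rfl⟩ := exists_sec_eq a
  obtain ⟨K, k, w, ⟨hl⟩, -⟩ := hk a
  refine ⟨K, k, by rw [res_sec, w, map_zero], fun T t ht => ?_⟩
  rw [res_sec, AddEquiv.map_eq_zero_iff] at ht
  exact ⟨hl.lift (KernelFork.ofι t ht), hl.fac _ WalkingParallelPair.zero⟩

theorem isCoherentFunctor_of_presentedBy (hk : c.HasAdmissibleKernels) {W : MorphismProperty E}
    (hF : presentedBy W F) : IsCoherentFunctor F := by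
  have := hc.additive
  have := hasBinaryBiproducts_of_finite_biproducts E
  obtain ⟨X, Y, f, -, ⟨e⟩⟩ := hF
  exact ((isCoherentFunctor_yoneda hk Y).cokernel (isFG_yoneda X) _).of_iso e.symm

omit hc in
/-- A presentation of a functor, given by a generator and a generator of its annihilator. -/
theorem presentedBy_of_elt {W : MorphismProperty E} {X Y : E} (π : preadditiveYoneda.obj Y ⟶ F)
    [Epi π] (f : X ⟶ Y) (hf : W f) (h0 : res F f (elt π) = 0)
    (h : ∀ (T : E) (t : T ⟶ Y), res F t (elt π) = 0 → ∃ s, s ≫ f = t) : presentedBy W F := by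
  have w : preadditiveYoneda.map f ≫ π = 0 := hom_ext_sec fun T t => by
    rw [ev_comp, ev_sec, ev_eq_res_elt, ← res_res, h0, map_zero, ev_zero]
  let d := cokernel.desc (preadditiveYoneda.map f) π w
  have hd : cokernel.π _ ≫ d = π := cokernel.π_desc _ _ _
  have : Epi d := epi_of_epi_fac hd
  have : Mono d := by
    rw [mono_iff_ev]
    intro T x hx
    obtain ⟨y, rfl⟩ := exists_ev_eq (cokernel.π _) x
    obtain ⟨t, rfl⟩ := exists_sec_eq y
    rw [← ev_comp, hd, ev_eq_res_elt] at hx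
    obtain ⟨s, rfl⟩ := h T t hx
    rw [← ev_sec, ← ev_comp, cokernel.condition, ev_zero]
  have := isIso_of_mono_of_epi d
  exact ⟨X, Y, f, hf, ⟨(asIso d).symm⟩⟩

/-- Let `y` generate `F`, let `g` be its image under `ψ`, and let `i` be the kernel of `g`, an
inflation. The restriction of `y` to `i` is killed by `ψ`, hence locally zero. So a deflation
factors through the generator `p` of its annihilator, and `p` is a deflation. Everything
annihilating `y` factors through `i`, so the admissible morphism `p ≫ i` presents `F`. -/
theorem modAd_of_locInj (hk : c.HasAdmissibleKernels) (hF : IsCoherentFunctor F) {W : E}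
    {ψ : F ⟶ preadditiveYoneda.obj W} (hψ : c.LocInj ψ) : c.modAd F := by
  obtain ⟨Y, π, _⟩ := hF.fg
  obtain ⟨g, hg⟩ := exists_sec_eq (ev ψ Y (elt π))
  obtain ⟨I, i, w, ⟨hl⟩, hi⟩ := hk g
  obtain ⟨P, p, hp, h⟩ := hF.rel I (res F i (elt π))
  obtain ⟨S, q, hq, h0⟩ := hψ I (res F i (elt π)) (by
    rw [ev_res, ← hg, res_sec, w, map_zero])
  obtain ⟨s, rfl⟩ := h S q h0
  refine presentedBy_of_elt π (p ≫ i) ⟨I, p, i, hc.deflation_of_comp hk hq, hi, rfl⟩ ?_ ?_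
  · rw [← res_res, hp]
  · intro T t ht
    have ht' : t ≫ g = 0 := by
      rw [← AddEquiv.map_eq_zero_iff sec, ← res_sec, hg, ← ev_res, ht, map_zero]
    have hr : hl.lift (KernelFork.ofι t ht') ≫ i = t := hl.fac _ WalkingParallelPair.zero
    obtain ⟨r, hr'⟩ := h T (hl.lift (KernelFork.ofι t ht')) (by rw [res_res, hr, ht])
    exact ⟨r, by rw [reassoc_of% hr', hr]⟩

/-- For a presentation `p ≫ i`, the cokernel `q` of `i` induces the map. An element it kills is
represented by a morphism through `i`, which lifts along `p` after pulling `p` back; local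
surjectivity comes from pulling back `q`. -/
theorem exists_locInj_locSurj (hF : c.modAd F) :
    ∃ (Z : E) (η : F ⟶ preadditiveYoneda.obj Z), c.LocInj η ∧ c.LocSurj η := by
  obtain ⟨X, Y, f, ⟨I, p, i, hp, ⟨Z, q, w, hq⟩, rfl⟩, ⟨e⟩⟩ := hF
  have hqd : c.deflation q := ⟨_, _, _, hq⟩
  have hw : preadditiveYoneda.map (p ≫ i) ≫ preadditiveYoneda.map q = 0 := by
    rw [← Functor.map_comp, Category.assoc, w, comp_zero, Functor.map_zero]
  let d := cokernel.desc _ _ hw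
  have hd : cokernel.π _ ≫ d = preadditiveYoneda.map q := cokernel.π_desc _ _ _
  have h₁ : c.LocInj d := fun T x hx => by
    obtain ⟨y, rfl⟩ := exists_ev_eq (cokernel.π _) x
    obtain ⟨t, rfl⟩ := exists_sec_eq y
    rw [← ev_comp, hd, ev_sec, AddEquiv.map_eq_zero_iff] at hx
    obtain ⟨s, hs⟩ := conflation.exists_lift hq t hx
    dsimp at s hs
    obtain ⟨P, s', p', sq, hp'⟩ := hc.pullback p s hp
    refine ⟨P, p', hp', ?_⟩
    rw [← ev_res, res_sec, ← hs, ← sq.w_assoc, ← ev_sec, ← ev_comp, cokernel.condition, ev_zero]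
  have h₂ : c.LocSurj (preadditiveYoneda.map q) := fun T z => by
    obtain ⟨z, rfl⟩ := exists_sec_eq z
    obtain ⟨P, z', q', sq, hq'⟩ := hc.pullback q z hqd
    exact ⟨P, q', sec z', hq', by rw [ev_sec, res_sec, sq.w]⟩
  rw [← hd] at h₂
  exact ⟨Z, e.hom ≫ d, (locInj_of_mono hc _).comp hc h₁, (locSurj_of_epi hc _).comp hc h₂.of_comp⟩

/-- Principal annihilators and a locally injective map to a representable functor are both inherited
by subfunctors; only finite generation has to be assumed. -/
theorem modAd_of_mono (hk : c.HasAdmissibleKernels) (hG : c.modAd G) (hF : IsFG F) (φ : F ⟶ G)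
    [Mono φ] : c.modAd F := by
  obtain ⟨Z, η, hη, -⟩ := exists_locInj_locSurj hc hG
  exact modAd_of_locInj hc hk ((isCoherentFunctor_of_presentedBy hc hk hG).of_mono φ hF)
    ((locInj_of_mono hc φ).comp hc hη)

theorem modAd_kernel (hk : c.HasAdmissibleKernels) (hF : c.modAd F) (hG : c.modAd G)
    (φ : F ⟶ G) : c.modAd (kernel φ) :=
  modAd_of_mono hc hk hF ((isCoherentFunctor_of_presentedBy hc hk hF).fg.kernel
    (isCoherentFunctor_of_presentedBy hc hk hG).rel φ) (kernel.ι φ)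

theorem modAd_image (hk : c.HasAdmissibleKernels) (hF : c.modAd F) (hG : c.modAd G)
    (φ : F ⟶ G) : c.modAd (Abelian.image φ) :=
  modAd_of_mono hc hk hG ((isCoherentFunctor_of_presentedBy hc hk hF).fg.of_epi
    (Abelian.factorThruImage φ)) (Abelian.image.ι φ)

theorem modAd_biprod (hk : c.HasAdmissibleKernels) (hF : c.modAd F) (hG : c.modAd G) :
    c.modAd (F ⊞ G) := by
  have := hc.additive
  have := hasBinaryBiproducts_of_finite_biproducts E
  obtain ⟨Z, η, hη, -⟩ := exists_locInj_locSurj hc hF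
  obtain ⟨W, θ, hθ, -⟩ := exists_locInj_locSurj hc hG
  refine modAd_of_locInj hc hk ((isCoherentFunctor_of_presentedBy hc hk hF).biprod
    (isCoherentFunctor_of_presentedBy hc hk hG))
    (ψ := biprod.desc (η ≫ preadditiveYoneda.map biprod.inl)
      (θ ≫ preadditiveYoneda.map (biprod.inr : W ⟶ Z ⊞ W))) fun T x hx => ?_
  have h₁ : ev (biprod.fst ≫ η) T x = 0 := by
    have := congrArg (ev (preadditiveYoneda.map biprod.fst) T) hx
    rw [map_zero, ← ev_comp] at this
    rw [← this]
    congr 2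
    apply biprod.hom_ext' <;> simp [← Functor.map_comp]
  have h₂ : ev (biprod.snd ≫ θ) T x = 0 := by
    have := congrArg (ev (preadditiveYoneda.map biprod.snd) T) hx
    rw [map_zero, ← ev_comp] at this
    rw [← this]
    congr 2
    apply biprod.hom_ext' <;> simp [← Functor.map_comp]
  obtain ⟨S, p, hp, h₃⟩ := hη T (ev biprod.fst T x) h₁
  refine isLocZero_of_res hc hp ?_
  obtain ⟨R, q, hq, h₄⟩ := hθ S (ev biprod.snd S (res _ p x)) (by
    rw [← ev_comp, ev_res, h₂, map_zero])
  exact ⟨R, q, hq, ev_biprod_eq_zero _ (by rw [ev_res, ev_res, h₃, map_zero]) (by rw [ev_res, h₄])⟩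

/-- For the converse, the generator of a coherent functor vanishes on some cover. That cover factors
through the generator of the annihilator, which is then a deflation. -/
theorem eff_iff (hk : c.HasAdmissibleKernels) :
    c.eff F ↔ IsCoherentFunctor F ∧ c.LocZero F := by
  constructor
  · intro hF
    refine ⟨isCoherentFunctor_of_presentedBy hc hk hF, ?_⟩
    obtain ⟨X, Y, f, hf, ⟨e⟩⟩ := hF
    intro T x
    obtain ⟨y, rfl⟩ := exists_ev_eq (cokernel.π (preadditiveYoneda.map f) ≫ e.inv) x
    obtain ⟨t, rfl⟩ := exists_sec_eq y
    obtain ⟨P, t', f', sq, hf'⟩ := hc.pullback f t hf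
    refine ⟨P, f', hf', ?_⟩
    rw [← ev_res, res_sec, ← sq.w, ← ev_sec, ← ev_comp, cokernel.condition_assoc, zero_comp,
      ev_zero]
  · rintro ⟨hF, h⟩
    obtain ⟨Y, π, _⟩ := hF.fg
    obtain ⟨P, p, hp, hrel⟩ := hF.rel Y (elt π)
    obtain ⟨S, q, hq, h0⟩ := h Y (elt π)
    obtain ⟨s, rfl⟩ := hrel S q h0
    exact presentedBy_of_elt π p (hc.deflation_of_comp hk hq) hp hrel

theorem eff_le_modAd (hk : c.HasAdmissibleKernels) : c.eff ≤ c.modAd := fun F hF => by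
  rw [eff_iff hc hk] at hF
  obtain ⟨Y, π, _⟩ := hF.1.fg
  -- On a locally zero functor even the zero map is locally injective; the choice of target is
  -- immaterial.
  exact modAd_of_locInj hc hk hF.1 (ψ := (0 : F ⟶ preadditiveYoneda.obj Y)) fun T x _ => hF.2 T x

end Local

/-! ### The conflation structure on `ModAd`, the percolating axioms, and the weak isomorphisms. -/

section ModAd

variable {E : Type u} [Category.{v} E] [Preadditive E] {c : ConflationStructure E}

theorem modAd_conflation_of_ev {F G H : c.ModAd} (f : F ⟶ G) (g : G ⟶ H) (w : f ≫ g = 0)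
    [Mono f.hom] [Epi g.hom] (h : ∀ T x, ev g.hom T x = 0 → ∃ y, ev f.hom T y = x) :
    c.modAdStructure.conflation (ShortComplex.mk f g w) := by
  have : Mono ((ShortComplex.mk f g w).map c.modAd.ι).f := ‹Mono f.hom›
  have : Epi ((ShortComplex.mk f g w).map c.modAd.ι).g := ‹Epi g.hom›
  exact shortExact_of_ev _ h

theorem modAd_mono_hom_of_conflation {S : ShortComplex c.ModAd}
    (h : c.modAdStructure.conflation S) : Mono S.f.hom :=
  ShortComplex.ShortExact.mono_f h

theorem modAd_epi_hom_of_conflation {S : ShortComplex c.ModAd}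
    (h : c.modAdStructure.conflation S) : Epi S.g.hom :=
  ShortComplex.ShortExact.epi_g h

theorem exists_ev_of_modAd_conflation {S : ShortComplex c.ModAd}
    (h : c.modAdStructure.conflation S) {T : E} (x : S.X₂.obj.obj (op T))
    (hx : ev S.g.hom T x = 0) : ∃ y, ev S.f.hom T y = x :=
  (exact_iff_ev _).1 (ShortComplex.ShortExact.exact h) T x hx

theorem modAd_epi_hom {F G : c.ModAd} {φ : F ⟶ G} (h : c.modAdStructure.deflation φ) :
    Epi φ.hom := by
  obtain ⟨K, k, w, h⟩ := h
  exact modAd_epi_hom_of_conflation h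

theorem modAd_mono_hom {F G : c.ModAd} {φ : F ⟶ G} (h : c.modAdStructure.inflation φ) :
    Mono φ.hom := by
  obtain ⟨K, k, w, h⟩ := h
  exact modAd_mono_hom_of_conflation h

variable (hc : c.IsDeflationExact) (hk : c.HasAdmissibleKernels)
include hc hk

theorem isCoherentFunctor_obj (F : c.ModAd) : IsCoherentFunctor F.obj :=
  isCoherentFunctor_of_presentedBy hc hk F.property

/-- The kernel of a morphism of functors presented by admissible morphisms. -/
def kerAd {F G : c.ModAd} (φ : F ⟶ G) : c.ModAd :=
  ⟨kernel φ.hom, modAd_kernel hc hk F.property G.property φ.hom⟩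

/-- The inclusion of the kernel. -/
def kerAdι {F G : c.ModAd} (φ : F ⟶ G) : kerAd hc hk φ ⟶ F :=
  ObjectProperty.homMk (kernel.ι φ.hom)

theorem kerAdι_comp {F G : c.ModAd} (φ : F ⟶ G) : kerAdι hc hk φ ≫ φ = 0 :=
  ObjectProperty.hom_ext _ (kernel.condition φ.hom)

/-- The image of a morphism of functors presented by admissible morphisms. -/
def imAd {F G : c.ModAd} (φ : F ⟶ G) : c.ModAd :=
  ⟨Abelian.image φ.hom, modAd_image hc hk F.property G.property φ.hom⟩

/-- The corestriction of a morphism to its image. -/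
def toImAd {F G : c.ModAd} (φ : F ⟶ G) : F ⟶ imAd hc hk φ :=
  ObjectProperty.homMk (Abelian.factorThruImage φ.hom)

/-- The inclusion of the image. -/
def imAdι {F G : c.ModAd} (φ : F ⟶ G) : imAd hc hk φ ⟶ G :=
  ObjectProperty.homMk (Abelian.image.ι φ.hom)

theorem toImAd_comp {F G : c.ModAd} (φ : F ⟶ G) : toImAd hc hk φ ≫ imAdι hc hk φ = φ :=
  ObjectProperty.hom_ext _ (Abelian.image.fac φ.hom)

theorem ev_imAdι_toImAd {F G : c.ModAd} (φ : F ⟶ G) {T : E} (x : F.obj.obj (op T)) :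
    ev (imAdι hc hk φ).hom T (ev (toImAd hc hk φ).hom T x) = ev φ.hom T x :=
  congrArg (fun t => ev t T x) (Abelian.image.fac φ.hom)

theorem modAd_conflation_kernel {F G : c.ModAd} (φ : F ⟶ G) [Epi φ.hom] :
    c.modAdStructure.conflation (ShortComplex.mk _ φ (kerAdι_comp hc hk φ)) := by
  have : Mono (kerAdι hc hk φ).hom := inferInstanceAs (Mono (kernel.ι φ.hom))
  exact modAd_conflation_of_ev _ _ _ fun T x hx => exists_ev_kernel φ.hom x hx

/-- Kernels never leave `ModAd`, so deflations are just the epimorphisms of functors. For a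
monomorphism to be an inflation, its cokernel must be shown to lie in `ModAd`. -/
theorem modAd_deflation_of_epi {F G : c.ModAd} (φ : F ⟶ G) [Epi φ.hom] :
    c.modAdStructure.deflation φ :=
  ⟨_, _, _, modAd_conflation_kernel hc hk φ⟩

omit hc hk in
theorem modAd_conflation_cokernel {F G : c.ModAd} (φ : F ⟶ G) [Mono φ.hom]
    (h : c.modAd (cokernel φ.hom)) :
    c.modAdStructure.conflation (ShortComplex.mk φ
      (ObjectProperty.homMk (cokernel.π φ.hom) : G ⟶ ⟨_, h⟩)
      (ObjectProperty.hom_ext _ (cokernel.condition φ.hom))) := by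
  have : Epi (ObjectProperty.homMk (cokernel.π φ.hom) : G ⟶ ⟨_, h⟩).hom :=
    inferInstanceAs (Epi (cokernel.π φ.hom))
  exact modAd_conflation_of_ev _ _ _ fun T x hx => exists_ev_cokernel φ.hom x hx

omit hk in
theorem exists_isZero_modAd : ∃ Z : c.ModAd, IsZero Z := by
  have := hc.additive
  obtain ⟨Z, hZ⟩ := hasZeroObject_of_hasFiniteBiproducts E |>.zero
  refine ⟨⟨_, hc.modAd_yoneda Z⟩, ?_⟩
  rw [IsZero.iff_id_eq_zero]
  refine ObjectProperty.hom_ext _ (hom_ext_sec fun T t => ?_)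
  rw [hZ.eq_of_tgt t 0, map_zero, map_zero, map_zero]

theorem modAd_hasFiniteBiproducts : HasFiniteBiproducts c.ModAd := by
  have : HasZeroObject c.ModAd := ⟨exists_isZero_modAd hc⟩
  have : HasBinaryBiproducts c.ModAd := ⟨fun F G => by
    refine hasBinaryBiproduct_of_total
      { pt := ⟨F.obj ⊞ G.obj, modAd_biprod hc hk F.property G.property⟩
        fst := ObjectProperty.homMk biprod.fst
        snd := ObjectProperty.homMk biprod.snd
        inl := ObjectProperty.homMk biprod.inl
        inr := ObjectProperty.homMk biprod.inr
        inl_fst := ObjectProperty.hom_ext _ biprod.inl_fst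
        inl_snd := ObjectProperty.hom_ext _ biprod.inl_snd
        inr_fst := ObjectProperty.hom_ext _ biprod.inr_fst
        inr_snd := ObjectProperty.hom_ext _ biprod.inr_snd }
      (ObjectProperty.hom_ext _ biprod.total)⟩
  have : HasFiniteProducts c.ModAd := hasFiniteProducts_of_has_binary_and_terminal
  exact HasFiniteBiproducts.of_hasFiniteProducts

/-- The pullback is a retract of the kernel of the difference map on the biproduct. As a quotient of
that kernel it is finitely generated, and as a subfunctor of it `modAd_of_mono` applies. -/
theorem modAd_pullback {F G H : c.ModAd} (φ : F ⟶ H) (ψ : G ⟶ H) :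
    c.modAd (pullback φ.hom ψ.hom) := by
  have := hc.additive
  have := hasBinaryBiproducts_of_finite_biproducts E
  have hFG := modAd_biprod hc hk F.property G.property
  let d : F.obj ⊞ G.obj ⟶ H.obj := biprod.fst ≫ φ.hom - biprod.snd ≫ ψ.hom
  let l : pullback φ.hom ψ.hom ⟶ F.obj ⊞ G.obj :=
    biprod.lift (pullback.fst _ _) (pullback.snd _ _)
  have hl : l ≫ d = 0 := by
    simp [l, d, Preadditive.comp_sub, pullback.condition]
  let r : kernel d ⟶ pullback φ.hom ψ.hom :=
    pullback.lift (kernel.ι d ≫ biprod.fst) (kernel.ι d ≫ biprod.snd) (by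
      rw [← sub_eq_zero, Category.assoc, Category.assoc, ← Preadditive.comp_sub]
      exact kernel.condition d)
  have hr : kernel.lift d l hl ≫ r = 𝟙 _ := by
    have h₁ : r ≫ pullback.fst _ _ = kernel.ι d ≫ biprod.fst := pullback.lift_fst _ _ _
    have h₂ : r ≫ pullback.snd _ _ = kernel.ι d ≫ biprod.snd := pullback.lift_snd _ _ _
    apply pullback.hom_ext
    · rw [Category.assoc, h₁, kernel.lift_ι_assoc, biprod.lift_fst, Category.id_comp]
    · rw [Category.assoc, h₂, kernel.lift_ι_assoc, biprod.lift_snd, Category.id_comp]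
  have : Mono (kernel.lift d l hl) := mono_of_mono_fac hr
  have : Epi r := epi_of_epi_fac hr
  exact modAd_of_mono hc hk (modAd_kernel hc hk hFG H.property d)
    (((isCoherentFunctor_of_presentedBy hc hk hFG).fg.kernel
      (isCoherentFunctor_obj hc hk H).rel d).of_epi r) (kernel.lift d l hl)

theorem modAd_isDeflationExact : c.modAdStructure.IsDeflationExact where
  additive := modAd_hasFiniteBiproducts hc hk
  to_zero F Z f hZ := by
    have : Epi f.hom := by
      have : Epi f := hZ.epi f
      refine ⟨fun {G} a b _ => ?_⟩
      have h0 : 𝟙 Z.obj = 0 := congrArg (fun t => t.hom) (hZ.eq_of_src (𝟙 Z) 0)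
      rw [← Category.id_comp a, ← Category.id_comp b, h0, zero_comp, zero_comp]
    exact modAd_deflation_of_epi hc hk f
  comp p q hp hq := by
    have := modAd_epi_hom hp
    have := modAd_epi_hom hq
    have : Epi (p ≫ q).hom := epi_comp p.hom q.hom
    exact modAd_deflation_of_epi hc hk _
  pullback {Y Z W} p f hp := by
    have := modAd_epi_hom hp
    let P : c.ModAd := ⟨pullback p.hom f.hom, modAd_pullback hc hk p f⟩
    let a : P ⟶ Y := ObjectProperty.homMk (pullback.fst p.hom f.hom)
    let b : P ⟶ W := ObjectProperty.homMk (pullback.snd p.hom f.hom)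
    have : Epi b.hom := inferInstanceAs (Epi (pullback.snd p.hom f.hom))
    exact ⟨P, a, b, IsPullback.of_map_of_faithful c.modAd.ι (IsPullback.of_hasPullback p.hom f.hom),
      modAd_deflation_of_epi hc hk b⟩

/-- The quotient by a kernel is the image, which is a finitely generated subfunctor of the target
and so lies in `ModAd`. -/
theorem modAd_hasAdmissibleKernels : c.modAdStructure.HasAdmissibleKernels := by
  intro F G φ
  have hm : Mono (kerAdι hc hk φ).hom := inferInstanceAs (Mono (kernel.ι φ.hom))
  have he : Epi (toImAd hc hk φ).hom := inferInstanceAs (Epi (Abelian.factorThruImage φ.hom))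
  have hi : Mono (imAdι hc hk φ).hom := inferInstanceAs (Mono (Abelian.image.ι φ.hom))
  have : Mono (kerAdι hc hk φ) := c.modAd.ι.mono_of_mono_map hm
  have : Mono (imAdι hc hk φ) := c.modAd.ι.mono_of_mono_map hi
  have w : kerAdι hc hk φ ≫ toImAd hc hk φ = 0 := by
    rw [← cancel_mono (imAdι hc hk φ), Category.assoc, toImAd_comp, kerAdι_comp, zero_comp]
  refine ⟨kerAd hc hk φ, kerAdι hc hk φ, kerAdι_comp hc hk φ,
    ⟨KernelFork.IsLimit.ofι' _ _ fun {A} k hk' => ?_⟩, _, _, w,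
    modAd_conflation_of_ev _ _ _ fun T x hx => exists_ev_kernel φ.hom x ?_⟩
  · exact ⟨ObjectProperty.homMk (kernel.lift φ.hom k.hom (congrArg (fun t => t.hom) hk')),
      ObjectProperty.hom_ext _ (kernel.lift_ι _ _ _)⟩
  · have := congrArg (ev (imAdι hc hk φ).hom T) hx
    rwa [map_zero, ev_imAdι_toImAd] at this

theorem effAd_iff (F : c.ModAd) : c.effAd F ↔ c.LocZero F.obj :=
  (eff_iff hc hk).trans ⟨fun h => h.2, fun h => ⟨isCoherentFunctor_obj hc hk F, h⟩⟩

theorem effAd_serre (S : ShortComplex c.ModAd) (hS : c.modAdStructure.conflation S) :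
    c.effAd S.X₂ ↔ c.effAd S.X₁ ∧ c.effAd S.X₃ := by
  have := modAd_mono_hom_of_conflation hS
  have := modAd_epi_hom_of_conflation hS
  rw [effAd_iff hc hk, effAd_iff hc hk, effAd_iff hc hk]
  constructor
  · refine fun h => ⟨fun T x => (locInj_of_mono hc S.f.hom).isLocZero hc (h T _), fun T x => ?_⟩
    obtain ⟨y, rfl⟩ := exists_ev_eq S.g.hom x
    exact (h T y).ev _
  · rintro ⟨h₁, h₃⟩ T x
    obtain ⟨R, p, hp, h0⟩ := h₃ T (ev S.g.hom T x)
    rw [← ev_res] at h0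
    obtain ⟨y, hy⟩ := exists_ev_of_modAd_conflation hS _ h0
    refine isLocZero_of_res hc hp ?_
    rw [← hy]
    exact (h₁ R y).ev _

/-- The cokernel is coherent and locally zero, hence effaceable. This is what makes monomorphisms
with locally zero cokernel inflations. -/
theorem modAd_cokernel_of_locSurj {F G : c.ModAd} (φ : F ⟶ G) (h : c.LocSurj φ.hom) :
    ∃ h : c.modAd (cokernel φ.hom), c.effAd ⟨_, h⟩ := by
  have := hc.additive
  have := hasBinaryBiproducts_of_finite_biproducts E
  have he : c.eff (cokernel φ.hom) := by
    rw [eff_iff hc hk]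
    refine ⟨(isCoherentFunctor_obj hc hk G).cokernel (isCoherentFunctor_obj hc hk F).fg _,
      fun T x => ?_⟩
    obtain ⟨y, rfl⟩ := exists_ev_eq (cokernel.π φ.hom) x
    obtain ⟨S, p, z, hp, hz⟩ := h T y
    exact ⟨S, p, hp, by rw [← ev_res, ← hz, ← ev_comp, cokernel.condition, ev_zero]⟩
  exact ⟨eff_le_modAd hc hk _ he, he⟩

theorem effAd_admissible_image {F G : c.ModAd} (φ : F ⟶ G) (hG : c.effAd G) :
    ∃ (Z : c.ModAd) (p : F ⟶ Z) (i : Z ⟶ G), c.effAd Z ∧ c.modAdStructure.deflation p ∧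
      c.modAdStructure.inflation i ∧ p ≫ i = φ := by
  have he : Epi (toImAd hc hk φ).hom := inferInstanceAs (Epi (Abelian.factorThruImage φ.hom))
  have hi : Mono (imAdι hc hk φ).hom := inferInstanceAs (Mono (Abelian.image.ι φ.hom))
  rw [effAd_iff hc hk] at hG
  obtain ⟨h, -⟩ := modAd_cokernel_of_locSurj hc hk (imAdι hc hk φ) fun T y => by
    obtain ⟨S, p, hp, h0⟩ := hG T y
    -- Every morphism to a locally zero functor is locally surjective, with `0` as local lift.
    exact ⟨S, p, 0, hp, by rw [map_zero, h0]⟩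
  refine ⟨imAd hc hk φ, toImAd hc hk φ, imAdι hc hk φ, ?_, modAd_deflation_of_epi hc hk _,
    ⟨_, _, _, modAd_conflation_cokernel _ h⟩, toImAd_comp hc hk φ⟩
  rw [effAd_iff hc hk]
  exact fun T x => (locInj_of_mono hc (imAdι hc hk φ).hom).isLocZero hc (hG T _)

/-- The pushout is the quotient of `Y` by the kernel of `f`. It is an extension of `Q`, the cokernel
of `g`, by `Z`, so the only issue is whether it lies in `ModAd`. -/
theorem effAd_pushout {X Y Z : c.ModAd} (f : X ⟶ Z) (g : X ⟶ Y) (hZ : c.effAd Z)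
    (hf : c.modAdStructure.deflation f) (hg : c.modAdStructure.inflation g) :
    ∃ (P : c.ModAd) (i' : Z ⟶ P) (f' : Y ⟶ P), IsPushout f g i' f' ∧
      c.modAdStructure.deflation f' ∧ c.modAdStructure.inflation i' := by
  have := hc.additive
  have := hasBinaryBiproducts_of_finite_biproducts E
  have := modAd_epi_hom hf
  have := modAd_mono_hom hg
  have hepi : Epi f := c.modAd.ι.epi_of_epi_map ‹Epi f.hom›
  obtain ⟨Q, q, w, hq⟩ := hg
  have := modAd_epi_hom_of_conflation hq
  dsimp at this
  let k := kernel.ι f.hom ≫ g.hom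
  let π := cokernel.π k
  let e : cokernel k ⟶ Q.obj := cokernel.desc k q.hom (by
    rw [Category.assoc]
    exact (congrArg (kernel.ι f.hom ≫ ·) (congrArg (fun t => t.hom) w)).trans comp_zero)
  have he : π ≫ e = q.hom := cokernel.π_desc _ _ _
  let j : Z.obj ⟶ cokernel k :=
    (Abelian.epiIsCokernelOfKernel _ (kernelIsKernel f.hom)).desc
      (CokernelCofork.ofπ (g.hom ≫ π) (by rw [← Category.assoc]; exact cokernel.condition k))
  have hj : f.hom ≫ j = g.hom ≫ π :=
    (Abelian.epiIsCokernelOfKernel _ (kernelIsKernel f.hom)).fac _ WalkingParallelPair.one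
  have hje : j ≫ e = 0 := by
    rw [← cancel_epi f.hom, reassoc_of% hj, he, comp_zero]
    exact congrArg (fun t => t.hom) w
  have hjm : Mono j := by
    rw [mono_iff_ev]
    intro T a ha
    obtain ⟨x, rfl⟩ := exists_ev_eq f.hom a
    rw [← ev_comp, hj, ev_comp] at ha
    obtain ⟨y, hy⟩ := exists_ev_cokernel k _ ha
    rw [ev_comp] at hy
    rw [← eq_of_ev_eq g.hom hy, ← ev_comp, kernel.condition, ev_zero]
  have hem : Epi e := epi_of_epi_fac he
  have hex : ∀ T x, ev e T x = 0 → ∃ y, ev j T y = x := by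
    intro T x hx
    obtain ⟨y, rfl⟩ := exists_ev_eq π x
    rw [← ev_comp, he] at hx
    obtain ⟨z, hz⟩ := exists_ev_of_modAd_conflation hq y hx
    exact ⟨ev f.hom T z, by rw [← ev_comp, hj, ev_comp]; exact congrArg _ hz⟩
  rw [effAd_iff hc hk] at hZ
  have hP : c.modAd (cokernel k) := by
    -- The kernel of `e` is the locally zero functor `Z`, so `e` is locally injective and the map
    -- from `Q` to a representable functor can be reused.
    obtain ⟨W, η, hη, -⟩ := exists_locInj_locSurj hc Q.property
    refine modAd_of_locInj hc hk ((isCoherentFunctor_obj hc hk Y).cokernel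
      ((isCoherentFunctor_obj hc hk X).fg.kernel (isCoherentFunctor_obj hc hk Z).rel _) k)
      (LocInj.comp hc (φ := e) (fun T x hx => ?_) hη)
    obtain ⟨y, rfl⟩ := hex T x hx
    exact (hZ T y).ev j
  let P : c.ModAd := ⟨cokernel k, hP⟩
  let i' : Z ⟶ P := ObjectProperty.homMk j
  let f' : Y ⟶ P := ObjectProperty.homMk π
  have : Mono i'.hom := hjm
  have : Epi f'.hom := inferInstanceAs (Epi (cokernel.π k))
  have hf' : Epi f' := c.modAd.ι.epi_of_epi_map ‹Epi f'.hom›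
  have : Epi (ObjectProperty.homMk e : P ⟶ Q).hom := hem
  have hw : f ≫ i' = g ≫ f' := ObjectProperty.hom_ext _ hj
  refine ⟨P, i', f', ⟨⟨hw⟩, ⟨PushoutCocone.IsColimit.mk hw
    (fun s => ObjectProperty.homMk (cokernel.desc k s.inr.hom ?_)) (fun s => ?_) (fun s => ?_)
    (fun s m _ hm => ?_)⟩⟩, modAd_deflation_of_epi hc hk f',
    Q, ObjectProperty.homMk e, ObjectProperty.hom_ext _ hje, modAd_conflation_of_ev _ _ _ hex⟩
  · have := congrArg (fun t => t.hom) s.condition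
    dsimp at this
    rw [Category.assoc, ← this, kernel.condition_assoc, zero_comp]
  · rw [← cancel_epi f, reassoc_of% hw]
    refine Eq.trans ?_ s.condition.symm
    congr 1
    exact ObjectProperty.hom_ext _ (cokernel.π_desc _ _ _)
  · exact ObjectProperty.hom_ext _ (cokernel.π_desc _ _ _)
  · rw [← cancel_epi f', hm]
    exact ObjectProperty.hom_ext _ (cokernel.π_desc _ _ _).symm

theorem effAd_isAdmissiblyDeflationPercolating :
    c.modAdStructure.IsAdmissiblyDeflationPercolating c.effAd where
  nonempty := by
    obtain ⟨Z, hZ⟩ := exists_isZero_modAd hc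
    refine ⟨Z, (effAd_iff hc hk Z).2 fun T x => ?_⟩
    have h0 : 𝟙 Z.obj = 0 := congrArg (fun t => t.hom) (hZ.eq_of_src (𝟙 Z) 0)
    rw [← ev_id T x, h0, ev_zero]
    exact isLocZero_zero hc T
  serre := effAd_serre hc hk
  admissible_image := effAd_admissible_image hc hk
  pushout := effAd_pushout hc hk

/-- Conversely, a locally bijective map is its corestriction to the image, a deflation with locally
zero kernel, followed by the inclusion of the image, an inflation with locally zero cokernel. -/
theorem weakIso_iff {F G : c.ModAd} (φ : F ⟶ G) :
    c.modAdStructure.weakIso c.effAd φ ↔ c.LocInj φ.hom ∧ c.LocSurj φ.hom := by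
  constructor
  · have key : ∀ {F G : c.ModAd} (φ : F ⟶ G),
        (∃ (Z : c.ModAd) (p : G ⟶ Z) (w : φ ≫ p = 0), c.effAd Z ∧
          c.modAdStructure.conflation (ShortComplex.mk φ p w)) ∨
        (∃ (K : c.ModAd) (k : K ⟶ F) (w : k ≫ φ = 0), c.effAd K ∧
          c.modAdStructure.conflation (ShortComplex.mk k φ w)) →
        c.LocInj φ.hom ∧ c.LocSurj φ.hom := by
      rintro F G φ (⟨Z, p, w, hZ, h⟩ | ⟨K, k, w, hK, h⟩)
      · have : Mono φ.hom := modAd_mono_hom_of_conflation h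
        refine ⟨locInj_of_mono hc _, fun T y => ?_⟩
        obtain ⟨S, q, hq, h0⟩ := (effAd_iff hc hk Z).1 hZ T (ev p.hom T y)
        rw [← ev_res] at h0
        obtain ⟨x, hx⟩ := exists_ev_of_modAd_conflation h _ h0
        exact ⟨S, q, x, hq, hx⟩
      · have : Epi φ.hom := modAd_epi_hom_of_conflation h
        refine ⟨fun T x hx => ?_, locSurj_of_epi hc _⟩
        obtain ⟨y, rfl⟩ := exists_ev_of_modAd_conflation h x hx
        exact ((effAd_iff hc hk K).1 hK T y).ev _
    intro h
    induction h with
    | of f hf => exact key f hf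
    | id F => exact ⟨locInj_of_mono hc (𝟙 F.obj), locSurj_of_epi hc (𝟙 F.obj)⟩
    | comp_of f g _ hg ih =>
      exact ⟨ih.1.comp hc (key g hg).1, ih.2.comp hc (key g hg).2⟩
  · rintro ⟨h₁, h₂⟩
    have he : Epi (toImAd hc hk φ).hom := inferInstanceAs (Epi (Abelian.factorThruImage φ.hom))
    have hi : Mono (imAdι hc hk φ).hom := inferInstanceAs (Mono (Abelian.image.ι φ.hom))
    have hfac := toImAd_comp hc hk φ
    have hfac' : (toImAd hc hk φ).hom ≫ (imAdι hc hk φ).hom = φ.hom :=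
      congrArg (fun t => t.hom) hfac
    rw [← hfac'] at h₁ h₂
    rw [← hfac]
    refine .comp_of _ _ (.of _ (Or.inr ⟨_, _, _, ?_, modAd_conflation_kernel hc hk _⟩)) (Or.inl ?_)
    · rw [effAd_iff hc hk]
      refine fun T x => LocInj.isLocZero hc
        (φ := kernel.ι (toImAd hc hk φ).hom) (locInj_of_mono hc _) (h₁.of_comp T _ ?_)
      exact congrArg (fun t => ev t T x) (kernel.condition (toImAd hc hk φ).hom)
    · obtain ⟨h, h'⟩ := modAd_cokernel_of_locSurj hc hk (imAdι hc hk φ) h₂.of_comp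
      exact ⟨_, _, _, h', modAd_conflation_cokernel _ h⟩

end ModAd

/-! ### The reflection onto representable functors, the quotient category and its conflations. -/

section Quotient

variable {E : Type u} [Category.{v} E] [Preadditive E] {c : ConflationStructure E}

/-- A morphism to a representable functor with locally vanishing kernel and cokernel is a
reflection onto the representable functors. -/
theorem existsUnique_reflection (hc : c.IsDeflationExact) (hk : c.HasAdmissibleKernels)
    {F : Eᵒᵖ ⥤ AddCommGrpCat.{v}} (hF : IsFG F) {Z W : E} {η : F ⟶ preadditiveYoneda.obj Z}
    (h₁ : c.LocInj η) (h₂ : c.LocSurj η) (ψ : F ⟶ preadditiveYoneda.obj W) :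
    ∃! w : Z ⟶ W, η ≫ preadditiveYoneda.map w = ψ := by
  obtain ⟨Y, π, _⟩ := hF
  obtain ⟨g, hg⟩ := exists_sec_eq (ev η Y (elt π))
  obtain ⟨f, hf⟩ := exists_sec_eq (ev ψ Y (elt π))
  have hg' : preadditiveYoneda.map g = π ≫ η := hom_ext_sec fun T t => by
    rw [ev_sec, ev_comp, ev_eq_res_elt, ev_res, ← hg, res_sec]
  have hf' : preadditiveYoneda.map f = π ≫ ψ := hom_ext_sec fun T t => by
    rw [ev_sec, ev_comp, ev_eq_res_elt, ev_res, ← hf, res_sec]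
  -- The generator of `F` has images `g` under `η` and `f` under `ψ`. The required `w` is the
  -- descent of `f` along the deflation `g`: what `g` kills is locally zero in `F`, hence killed by
  -- `f`.
  have hd : c.deflation g := LocSurj.deflation hc hk (by
    rw [hg']; exact (locSurj_of_epi hc π).comp hc h₂)
  have := hd.epi
  obtain ⟨w, hw⟩ := hd.exists_desc f fun T t ht => by
    refine IsLocZero.eq_zero (c := c) ?_
    rw [← res_sec, hf, ← ev_res]
    refine (h₁ T _ ?_).ev ψ
    rw [ev_res, ← hg, res_sec, ht, map_zero]
  refine ⟨w, ?_, fun w' hw' => ?_⟩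
  · change η ≫ preadditiveYoneda.map w = ψ
    rw [← cancel_epi π, ← hf', ← hw, Functor.map_comp, hg', Category.assoc]
  · refine (cancel_epi g).1 (preadditiveYoneda.map_injective ?_)
    rw [hw, hf', Functor.map_comp, hg', Category.assoc, hw']

variable (hc : c.IsDeflationExact) (hk : c.HasAdmissibleKernels)

/-- The object representing the reflection of a functor presented by an admissible morphism. -/
def reflObj (F : c.ModAd) : E := (exists_locInj_locSurj hc F.property).choose

/-- The reflection morphism. -/
def toRefl (F : c.ModAd) : F.obj ⟶ preadditiveYoneda.obj (reflObj hc F) :=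
  (exists_locInj_locSurj hc F.property).choose_spec.choose

theorem locInj_toRefl (F : c.ModAd) : c.LocInj (toRefl hc F) :=
  (exists_locInj_locSurj hc F.property).choose_spec.choose_spec.1

theorem locSurj_toRefl (F : c.ModAd) : c.LocSurj (toRefl hc F) :=
  (exists_locInj_locSurj hc F.property).choose_spec.choose_spec.2

include hk in
theorem bijective_reflHom (F : c.ModAd) (W : E) :
    Function.Bijective fun w : reflObj hc F ⟶ W =>
      (ObjectProperty.homMk (toRefl hc F ≫ preadditiveYoneda.map w) :
        F ⟶ (yonedaAd hc).obj W) := by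
  have h := fun ψ => existsUnique_reflection (W := W) hc hk (isCoherentFunctor_obj hc hk F).fg
    (locInj_toRefl hc F) (locSurj_toRefl hc F) ψ
  refine ⟨fun a b hab => ?_, fun ψ => ?_⟩
  · exact (h (toRefl hc F ≫ preadditiveYoneda.map b)).unique (congrArg (fun t => t.hom) hab) rfl
  · obtain ⟨w, hw, -⟩ := h ψ.hom
    exact ⟨w, ObjectProperty.hom_ext _ hw⟩

/-- The universal property of the reflection. -/
def reflEquiv (F : c.ModAd) (W : E) : (reflObj hc F ⟶ W) ≃ (F ⟶ (yonedaAd hc).obj W) :=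
  Equiv.ofBijective _ (bijective_reflHom hc hk F W)

theorem reflEquiv_comp (F : c.ModAd) (W W' : E) (g : W ⟶ W') (h : reflObj hc F ⟶ W) :
    reflEquiv hc hk F W' (h ≫ g) = reflEquiv hc hk F W h ≫ (yonedaAd hc).map g :=
  ObjectProperty.hom_ext _ (by
    change toRefl hc F ≫ preadditiveYoneda.map (h ≫ g) =
      (toRefl hc F ≫ preadditiveYoneda.map h) ≫ preadditiveYoneda.map g
    rw [Functor.map_comp, Category.assoc])

/-- The left adjoint of the Yoneda embedding into the category of functors presented by admissible
morphisms. -/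
def refl : c.ModAd ⥤ E := Adjunction.leftAdjointOfEquiv (reflEquiv hc hk) (reflEquiv_comp hc hk)

/-- The reflection is left adjoint to the Yoneda embedding. -/
def reflAdj : refl hc hk ⊣ yonedaAd hc :=
  Adjunction.adjunctionOfEquivLeft (reflEquiv hc hk) (reflEquiv_comp hc hk)

/-- The unit of the reflection, as a morphism of functors. -/
def reflUnit (F : c.ModAd) : F.obj ⟶ preadditiveYoneda.obj ((refl hc hk).obj F) := toRefl hc F

theorem locInj_reflUnit (F : c.ModAd) : c.LocInj (reflUnit hc hk F) := locInj_toRefl hc F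

theorem locSurj_reflUnit (F : c.ModAd) : c.LocSurj (reflUnit hc hk F) := locSurj_toRefl hc F

theorem reflUnit_naturality {F G : c.ModAd} (φ : F ⟶ G) :
    reflUnit hc hk F ≫ preadditiveYoneda.map ((refl hc hk).map φ) =
      φ.hom ≫ reflUnit hc hk G := by
  have h : reflEquiv hc hk F _ ((refl hc hk).map φ) =
      φ ≫ reflEquiv hc hk G _ (𝟙 (reflObj hc G)) :=
    (reflEquiv hc hk F _).apply_symm_apply _
  refine (congrArg (fun t => t.hom) h).trans ?_
  change φ.hom ≫ toRefl hc G ≫ preadditiveYoneda.map (𝟙 (reflObj hc G)) = φ.hom ≫ toRefl hc G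
  rw [CategoryTheory.Functor.map_id, Category.comp_id]

instance : (yonedaAd hc).Full :=
  inferInstanceAs (c.modAd.lift preadditiveYoneda hc.modAd_yoneda).Full

instance : (yonedaAd hc).Faithful :=
  inferInstanceAs (c.modAd.lift preadditiveYoneda hc.modAd_yoneda).Faithful

/-- The units are locally bijective, so by naturality `φ` is locally bijective exactly when its
reflection is. Between representables this means a monic deflation, that is, an isomorphism. -/
theorem isIso_refl_map_iff {F G : c.ModAd} (φ : F ⟶ G) :
    IsIso ((refl hc hk).map φ) ↔ c.LocInj φ.hom ∧ c.LocSurj φ.hom := by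
  have hφ := reflUnit_naturality hc hk φ
  constructor
  · intro h
    have h₁ : c.LocInj (φ.hom ≫ reflUnit hc hk G) :=
      hφ ▸ (locInj_reflUnit hc hk F).comp hc (locInj_of_mono hc _)
    have h₂ : c.LocSurj (φ.hom ≫ reflUnit hc hk G) :=
      hφ ▸ (locSurj_reflUnit hc hk F).comp hc (locSurj_of_epi hc _)
    exact ⟨h₁.of_comp, h₂.of_comp_locInj hc (locInj_reflUnit hc hk G)⟩
  · rintro ⟨h₁, h₂⟩
    have k₁ := h₁.comp hc (locInj_reflUnit hc hk G)
    have k₂ := h₂.comp hc (locSurj_reflUnit hc hk G)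
    rw [← hφ] at k₁ k₂
    have := (k₁.of_comp_locSurj hc (locSurj_reflUnit hc hk F)).mono
    exact (LocSurj.deflation hc hk k₂.of_comp).isIso

/-- A left adjoint of a fully faithful functor is a localization at the morphisms it inverts. -/
theorem refl_isLocalization : (refl hc hk).IsLocalization (c.modAdStructure.weakIso c.effAd) := by
  have : c.modAdStructure.weakIso c.effAd =
      (MorphismProperty.isomorphisms E).inverseImage (refl hc hk) := by
    ext F G φ
    rw [weakIso_iff hc hk, ← isIso_refl_map_iff hc hk]
    rfl
  rw [this]
  exact (reflAdj hc hk).isLocalization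

/-- The quotient category is equivalent to the original category through the reflection. -/
def quotEquiv : c.modAdStructure.QuotCat c.effAd ≌ E :=
  have := refl_isLocalization hc hk
  Localization.equivalenceFromModel (refl hc hk) (c.modAdStructure.weakIso c.effAd)

/-- The equivalence from the quotient category is induced by the reflection. -/
def quotFunctorCompEquiv :
    c.modAdStructure.quotFunctor c.effAd ⋙ (quotEquiv hc hk).functor ≅ refl hc hk :=
  have := refl_isLocalization hc hk
  Localization.qCompEquivalenceFromModelFunctorIso (refl hc hk)
    (c.modAdStructure.weakIso c.effAd)

/-- The equivalence from the quotient category is inverse to the Yoneda embedding. -/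
def yonedaQuotCompEquiv :
    (yonedaAd hc ⋙ c.modAdStructure.quotFunctor c.effAd) ⋙ (quotEquiv hc hk).functor ≅ 𝟭 E :=
  Functor.associator _ _ _ ≪≫ Functor.isoWhiskerLeft _ (quotFunctorCompEquiv hc hk) ≪≫
    asIso (reflAdj hc hk).counit

include hk in
theorem isEquivalence_yoneda_quot :
    (yonedaAd hc ⋙ c.modAdStructure.quotFunctor c.effAd).IsEquivalence := by
  have := Functor.isEquivalence_of_iso (yonedaQuotCompEquiv hc hk).symm
  exact Functor.isEquivalence_of_comp_right _ (quotEquiv hc hk).functor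

instance : (refl hc hk).PreservesZeroMorphisms :=
  have := (reflAdj hc hk).isLeftAdjoint
  CategoryTheory.Functor.preservesZeroMorphisms_of_isLeftAdjoint _

/-- The locally bijective units turn exactness of functors into local exactness of the reflected
sequence; descent along deflations then makes it a kernel-cokernel pair. -/
theorem conflation_refl {F G H : c.ModAd} (f : F ⟶ G) (g : G ⟶ H) (w : f ≫ g = 0)
    (hS : c.modAdStructure.conflation (ShortComplex.mk f g w)) :
    c.conflation (ShortComplex.mk ((refl hc hk).map f) ((refl hc hk).map g)
      (by rw [← Functor.map_comp, w, Functor.map_zero])) := by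
  have : Mono f.hom := modAd_mono_hom_of_conflation hS
  have : Epi g.hom := modAd_epi_hom_of_conflation hS
  have hf := reflUnit_naturality hc hk f
  have hg := reflUnit_naturality hc hk g
  have hfm : Mono ((refl hc hk).map f) := by
    refine LocInj.mono (LocInj.of_comp_locSurj hc ?_ (locSurj_reflUnit hc hk F))
    exact hf ▸ (locInj_of_mono hc f.hom).comp hc (locInj_reflUnit hc hk G)
  have hgd : c.deflation ((refl hc hk).map g) := by
    refine LocSurj.deflation hc hk (LocSurj.of_comp (φ := reflUnit hc hk G) ?_)
    exact hg ▸ (locSurj_of_epi hc g.hom).comp hc (locSurj_reflUnit hc hk H)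
  refine deflation.conflation hgd fun T t ht => ?_
  change T ⟶ (refl hc hk).obj G at t
  change t ≫ (refl hc hk).map g = 0 at ht
  change ∃ s : T ⟶ (refl hc hk).obj F, s ≫ (refl hc hk).map f = t
  obtain ⟨A, p, x, hp, hx⟩ := locSurj_reflUnit hc hk G T (sec t)
  obtain ⟨B, q, hq, h0⟩ := locInj_reflUnit hc hk H A (ev g.hom A x) (by
    rw [← ev_comp, ← hg, ev_comp, hx, res_sec, ev_sec, Category.assoc, ht, comp_zero, map_zero])
  rw [← ev_res] at h0
  obtain ⟨y, hy⟩ := exists_ev_of_modAd_conflation hS _ h0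
  change ev f.hom B y = _ at hy
  obtain ⟨s, hs⟩ := exists_sec_eq (ev (reflUnit hc hk F) B y)
  have hqp : c.deflation (q ≫ p) := hc.comp _ _ hq hp
  have hs' : s ≫ (refl hc hk).map f = (q ≫ p) ≫ t := by
    apply sec.injective
    rw [← ev_sec, hs, ← ev_comp, hf, ev_comp, hy, ev_res, hx, res_sec, res_sec, Category.assoc]
  have := hqp.epi
  -- The local lift `s` descends along the cover because lifts through the mono `(refl hc hk).map f`
  -- are unique.
  obtain ⟨n, hn⟩ := hqp.exists_desc s fun R r hr => by
    rw [← cancel_mono ((refl hc hk).map f), Category.assoc, hs', ← Category.assoc, hr,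
      zero_comp, zero_comp]
  exact ⟨n, by rw [← cancel_epi (q ≫ p), ← Category.assoc, hn, hs']⟩

include hk in
-- The Yoneda image of `S` is only left exact. Replacing its last term by the image of `g` makes it
-- short exact, and the inclusion of this image is a weak isomorphism because the deflation `S.g`
-- pulls back.
theorem quotConflation_of_conflation (S : ShortComplex E) (hS : c.conflation S) :
    c.modAdStructure.quotConflation c.effAd
      ((yonedaAd hc ⋙ c.modAdStructure.quotFunctor c.effAd).map S.f)
      ((yonedaAd hc ⋙ c.modAdStructure.quotFunctor c.effAd).map S.g) := by
  let f := (yonedaAd hc).map S.f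
  let g := (yonedaAd hc).map S.g
  have he : Epi (toImAd hc hk g).hom := inferInstanceAs (Epi (Abelian.factorThruImage g.hom))
  have hi : Mono (imAdι hc hk g).hom := inferInstanceAs (Mono (Abelian.image.ι g.hom))
  have : Mono (imAdι hc hk g) := c.modAd.ι.mono_of_mono_map hi
  have hfm : Mono S.f := inflation.mono (c := c) ⟨_, _, _, hS⟩
  have hm : Mono f.hom := by
    rw [mono_iff_ev]
    intro T x hx
    obtain ⟨t, rfl⟩ := exists_sec_eq x
    change sec (t ≫ S.f) = 0 at hx
    rw [AddEquiv.map_eq_zero_iff] at hx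
    have ht : t = 0 := by rw [← cancel_mono S.f, hx, zero_comp]
    rw [ht]
    exact map_zero sec
  have hfg : f ≫ g = 0 := by
    refine ObjectProperty.hom_ext _ (hom_ext_sec fun T t => ?_)
    change sec ((t ≫ S.f) ≫ S.g) = 0
    rw [Category.assoc, S.zero, comp_zero, map_zero]
  have w : f ≫ toImAd hc hk g = 0 := by
    rw [← cancel_mono (imAdι hc hk g), Category.assoc, toImAd_comp, hfg, zero_comp]
  have hT : c.modAdStructure.conflation (ShortComplex.mk f (toImAd hc hk g) w) := by
    refine modAd_conflation_of_ev _ _ _ fun T x hx => ?_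
    have h := congrArg (ev (imAdι hc hk g).hom T) hx
    rw [map_zero, ev_imAdι_toImAd] at h
    obtain ⟨t, rfl⟩ := exists_sec_eq x
    change sec (t ≫ S.g) = 0 at h
    rw [AddEquiv.map_eq_zero_iff] at h
    obtain ⟨s, rfl⟩ := conflation.exists_lift hS t h
    exact ⟨sec s, rfl⟩
  have hW : c.modAdStructure.weakIso c.effAd (imAdι hc hk g) := by
    rw [weakIso_iff hc hk]
    refine ⟨locInj_of_mono hc _, fun T z => ?_⟩
    obtain ⟨z, rfl⟩ := exists_sec_eq z
    obtain ⟨P, z', p, sq, hp⟩ := hc.pullback S.g z ⟨_, _, _, hS⟩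
    refine ⟨P, p, ev (toImAd hc hk g).hom P (sec z'), hp, ?_⟩
    exact (ev_imAdι_toImAd hc hk g (sec z')).trans (congrArg sec sq.w)
  have : IsIso ((c.modAdStructure.quotFunctor c.effAd).map (imAdι hc hk g)) :=
    Localization.inverts (c.modAdStructure.quotFunctor c.effAd) _ _ hW
  refine ⟨_, Iso.refl _, Iso.refl _,
    asIso ((c.modAdStructure.quotFunctor c.effAd).map (imAdι hc hk g)), hT, ?_, ?_⟩
  · exact (Category.comp_id _).trans (Category.id_comp _).symm
  · refine Eq.trans ?_ (Category.id_comp _).symm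
    change _ = (c.modAdStructure.quotFunctor c.effAd).map g
    exact ((c.modAdStructure.quotFunctor c.effAd).map_comp _ _).symm.trans
      (congrArg (c.modAdStructure.quotFunctor c.effAd).map (toImAd_comp hc hk g))

include hk in
theorem conflation_of_quotConflation (S : ShortComplex E)
    (hS : c.modAdStructure.quotConflation c.effAd
      ((yonedaAd hc ⋙ c.modAdStructure.quotFunctor c.effAd).map S.f)
      ((yonedaAd hc ⋙ c.modAdStructure.quotFunctor c.effAd).map S.g)) : c.conflation S := by
  obtain ⟨T, e₁, e₂, e₃, hT, h₁, h₂⟩ := hS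
  let K := (quotEquiv hc hk).functor
  let α := quotFunctorCompEquiv hc hk
  let γ := yonedaQuotCompEquiv hc hk
  -- A commutative square in the quotient, transported by `K`, `α` and `γ`, becomes a square in `E`.
  -- Applied to both maps, this identifies `S` with the reflection of `T`.
  have key : ∀ {A B : c.ModAd} {X Y : E} (a : A ⟶ B) (x : X ⟶ Y)
      (e : (c.modAdStructure.quotFunctor c.effAd).obj A ⟶
        (c.modAdStructure.quotFunctor c.effAd).obj ((yonedaAd hc).obj X))
      (e' : (c.modAdStructure.quotFunctor c.effAd).obj B ⟶
        (c.modAdStructure.quotFunctor c.effAd).obj ((yonedaAd hc).obj Y)),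
      (c.modAdStructure.quotFunctor c.effAd).map a ≫ e' =
        e ≫ (yonedaAd hc ⋙ c.modAdStructure.quotFunctor c.effAd).map x →
      (α.inv.app A ≫ K.map e ≫ γ.hom.app X) ≫ x =
        (refl hc hk).map a ≫ α.inv.app B ≫ K.map e' ≫ γ.hom.app Y := by
    intro A B X Y a x e e' h
    have n₁ := γ.hom.naturality x
    have n₂ := α.inv.naturality a
    have n₃ := congrArg K.map h
    rw [Functor.map_comp, Functor.map_comp] at n₃
    rw [reassoc_of% n₂, Category.assoc, Category.assoc]
    congr 1
    refine Eq.trans ?_ (congrArg (· ≫ γ.hom.app Y) n₃.symm |>.trans (Category.assoc _ _ _))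
    rw [Category.assoc]
    exact congrArg (K.map e ≫ ·) n₁.symm
  let e (A : c.ModAd) (X : E) (i : (c.modAdStructure.quotFunctor c.effAd).obj A ≅
      (yonedaAd hc ⋙ c.modAdStructure.quotFunctor c.effAd).obj X) : (refl hc hk).obj A ≅ X :=
    α.symm.app A ≪≫ K.mapIso i ≪≫ γ.app X
  exact c.of_iso _ _ (ShortComplex.isoMk (e _ _ e₁) (e _ _ e₂) (e _ _ e₃)
    (key _ _ _ _ h₁) (key _ _ _ _ h₂)) (conflation_refl hc hk T.f T.g T.zero hT)

end Quotient

end ConflationStructure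

end

theorem mainTheorem6 {E : Type u} [Category.{v} E] [Preadditive E] (c : ConflationStructure E)
    (hc : c.IsDeflationExact) (hk : c.HasAdmissibleKernels) :
    (c.modAdStructure.IsDeflationExact ∧ c.modAdStructure.HasAdmissibleKernels) ∧
    (c.eff ≤ c.modAd ∧ c.modAdStructure.IsAdmissiblyDeflationPercolating c.effAd) ∧
    (ConflationStructure.yonedaAd hc ⋙ c.modAdStructure.quotFunctor c.effAd).IsEquivalence ∧
    (∀ S : ShortComplex E, c.conflation S ↔
      c.modAdStructure.quotConflation c.effAd
        ((ConflationStructure.yonedaAd hc ⋙ c.modAdStructure.quotFunctor c.effAd).map S.f)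
        ((ConflationStructure.yonedaAd hc ⋙ c.modAdStructure.quotFunctor c.effAd).map S.g)) :=
  ⟨⟨ConflationStructure.modAd_isDeflationExact hc hk,
      ConflationStructure.modAd_hasAdmissibleKernels hc hk⟩,
    ⟨ConflationStructure.eff_le_modAd hc hk,
      ConflationStructure.effAd_isAdmissiblyDeflationPercolating hc hk⟩,
    ConflationStructure.isEquivalence_yoneda_quot hc hk,
    fun S => ⟨ConflationStructure.quotConflation_of_conflation hc hk S,
      ConflationStructure.conflation_of_quotConflation hc hk S⟩⟩
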